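/- Let $\Delta$ be a negative integer with $\Delta \equiv 0$ or $1 \pmod 4$, and let $\pi \in \{0,1\}$ with $\pi \equiv \Delta \pmod 2$, so that $\Delta \equiv \pi^2 \pmod 4$. Write $[a,b,c]$ for the binary quadratic form $ax^2+bxy+cy^2$ over $\mathbb{Z}$, of discriminant $b^2-4ac$; it is primitive if $\gcd(a,b,c)=1$. Let $\mathrm{GL}_2(\mathbb{Z})$ act on forms by the twisted action $(M\cdot q)(x,y) = \det(M)^{-1}\, q(\alpha x+\beta y, \gamma x+\delta y)$ for $M = \begin{pmatrix}\alpha&\beta\\ \gamma&\delta\end{pmatrix}$, and let $\mathrm{Cl}^{tw}_{\mathbb{Z}}(\Delta)$ be the set of twisted equivalence classes of primitive forms of discriminant $\Delta$. It is an abelian group, with the structure transported through the bijection $$\mathrm{Cl}^{tw}_{\mathbb{Z}}(\Delta) \to \mathrm{Pic}\Big(\mathbb{Z}[\omega]/\big(\omega^2+\pi\omega-\tfrac{\Delta-\pi^2}{4}\big)\Big),\qquad [a,b,c] \mapsto \Big[\big\langle \omega+\tfrac{\pi-b}{2},\, a\big\rangle\Big].$$ For a form $q$ let $\mathrm{Val}_\Delta(q)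 = \{q(x,y) : x,y\in \mathbb{Z}/\Delta\}\cap(\mathbb{Z}/\Delta)^\times$, and for a class $C$ of forms let $H_C = \bigcup_{q\in C}\mathrm{Val}_\Delta(q)$. Let $q_0 = [1,\pi,-\frac{\Delta-\pi^2}{4}]$ be the principal form; $\mathrm{Val}_\Delta(q_0)$ and $\pm\mathrm{Val}_\Delta(q_0)$ are subgroups of $(\mathbb{Z}/\Delta)^\times$. Let $\chi : (\mathbb{Z}/\Delta)^\times \to \{\pm1\}$ be the character with $\chi(p) = \left(\frac{\Delta}{p}\right)$ (Legendre symbol) for all odd primes $p\nmid\Delta$. Then: 1. $\mathrm{Val}_\Delta(q_0) \subseteq \ker\chi$, and the homomorphism $\varphi : \ker(\chi)/\mathrm{Val}_\Delta(q_0) \to (\mathbb{Z}/\Delta)^\times/\pm\mathrm{Val}_\Delta(q_0)$ induced by the inclusion $\ker\chi\subseteq(\mathbb{Z}/\Delta)^\times$ is an isomorphism. 2. For every class $C$ the set $H_C$ is a coset of $\pm\mathrm{Val}_\Delta(q_0)$, the map $\psi : \mathrm{Cl}^{tw}_{\mathbb{Z}}(\Delta) \to (\mathbb{Z}/\Delta)^\times/\pm\mathrm{Val}_\Delta(q_0)$,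 $C\mapsto H_C$, is a group homomorphism, and it induces an isomorphism of abelian groups (the genus map) $$\Psi_{\mathbb{Z}} : \mathrm{Cl}^{tw}_{\mathbb{Z}}(\Delta)/\mathrm{Cl}^{tw}_{\mathbb{Z}}(\Delta)^{\square} \to (\mathbb{Z}/\Delta)^\times/\pm\mathrm{Val}_\Delta(q_0),$$ where $\square$ denotes the subgroup of squares. In particular the principal genus $\ker\psi$ equals the subgroup of squares. -/

import Mathlib

namespace GenusTheory

/-- The binary quadratic form `a x² + b x y + c y²`. -/
@[ext]
structure BinForm (R : Type*) where
  a : R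
  b : R
  c : R

namespace BinForm

variable {R : Type*} [CommRing R]

/-- The value `q(x, y)`. -/
def eval (q : BinForm R) (x y : R) : R := q.a * x ^ 2 + q.b * x * y + q.c * y ^ 2

def disc (q : BinForm R) : R := q.b ^ 2 - 4 * q.a * q.c

/-- The coefficients generate the unit ideal. -/
def IsPrimitive (q : BinForm R) : Prop := Ideal.span {q.a, q.b, q.c} = ⊤

/-- Base change of a form along a ring homomorphism. -/
def map {S : Type*} [CommRing S] (f : R →+* S) (q : BinForm R) : BinForm S :=
  ⟨f q.a, f q.b, f q.c⟩

/-- The twisted action `(M · q)(x, y) = det(M)⁻¹ q(αx + βy, γx + δy)` for `M = (α β; γ δ)`. -/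
def twist (M : GL (Fin 2) R) (q : BinForm R) : BinForm R where
  a := ((Matrix.GeneralLinearGroup.det M)⁻¹ : Rˣ) * q.eval (M 0 0) (M 1 0)
  b := ((Matrix.GeneralLinearGroup.det M)⁻¹ : Rˣ) *
    (2 * q.a * M 0 0 * M 0 1 + q.b * (M 0 0 * M 1 1 + M 0 1 * M 1 0) + 2 * q.c * M 1 0 * M 1 1)
  c := ((Matrix.GeneralLinearGroup.det M)⁻¹ : Rˣ) * q.eval (M 0 1) (M 1 1)

theorem eval_twist (M : GL (Fin 2) R) (q : BinForm R) (x y : R) :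
    (q.twist M).eval x y = ((Matrix.GeneralLinearGroup.det M)⁻¹ : Rˣ) *
      q.eval (M 0 0 * x + M 0 1 * y) (M 1 0 * x + M 1 1 * y) := by
  simp only [twist, eval]
  ring

theorem twist_one (q : BinForm R) : q.twist 1 = q := by
  ext <;> simp [twist, eval]

theorem twist_twist (M N : GL (Fin 2) R) (q : BinForm R) :
    (q.twist M).twist N = q.twist (M * N) := by
  ext <;> simp only [twist, eval, map_mul, mul_inv, Units.val_mul, Matrix.mul_apply,
    Fin.sum_univ_two] <;> ring

end BinForm

/-- Primitive binary quadratic forms over `R` of discriminant `Δ`. -/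
abbrev PrimForm (R : Type*) [CommRing R] (Δ : R) : Type _ :=
  {q : BinForm R // q.IsPrimitive ∧ q.disc = Δ}

/-- Equivalence of primitive forms under the twisted action of `GL₂(R)`. -/
def twSetoid (R : Type*) [CommRing R] (Δ : R) : Setoid (PrimForm R Δ) where
  r q q' := ∃ M : GL (Fin 2) R, q'.1 = q.1.twist M
  iseqv := by
    refine ⟨fun q => ⟨1, q.1.twist_one.symm⟩, ?_, ?_⟩
    · rintro q q' ⟨M, h⟩
      exact ⟨M⁻¹, by rw [h, BinForm.twist_twist, mul_inv_cancel, BinForm.twist_one]⟩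
    · rintro q q' q'' ⟨M, h⟩ ⟨N, h'⟩
      exact ⟨M * N, by rw [h', h, BinForm.twist_twist]⟩

/-- The set of twisted equivalence classes of primitive forms of discriminant `Δ`. -/
def ClTw (R : Type*) [CommRing R] (Δ : R) : Type _ := Quotient (twSetoid R Δ)

namespace ClTw

/-- The class of a form. -/
def mk {R : Type*} [CommRing R] {Δ : R} (q : PrimForm R Δ) : ClTw R Δ :=
  Quotient.mk (twSetoid R Δ) q

end ClTw

/-- `Δ` is a negative integer with `Δ ≡ 0, 1 mod 4`. -/
class NegDisc (Δ : ℤ) : Prop where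
  neg : Δ < 0
  mod_four : Δ ≡ 0 [ZMOD 4] ∨ Δ ≡ 1 [ZMOD 4]

/-- An integer `π` with `Δ ≡ π² mod 4`. -/
def parity (Δ : ℤ) : ℤ := Δ % 2

/-- The principal form `[1, π, -(Δ - π²) / 4]`. -/
def principalForm (Δ : ℤ) : BinForm ℤ := ⟨1, parity Δ, -((Δ - parity Δ ^ 2) / 4)⟩

/-- The quadratic order `ℤ[ω] / (ω² + π ω - (Δ - π²) / 4)` of discriminant `Δ`; its elements
`r + s ω` are written `⟨r, s⟩`. -/
abbrev QuadOrder (Δ : ℤ) : Type := QuadraticAlgebra ℤ ((Δ - parity Δ ^ 2) / 4) (-parity Δ)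

section Order

set_option linter.unusedSectionVars false

variable {Δ : ℤ} [hΔ : NegDisc Δ]

theorem four_mul_par : 4 * ((Δ - parity Δ ^ 2) / 4) = Δ - parity Δ ^ 2 := by
  apply Int.mul_ediv_cancel'
  unfold parity
  rcases hΔ.mod_four with h | h
  · have h2 : Δ % 2 = 0 := by unfold Int.ModEq at h; omega
    rw [h2]; unfold Int.ModEq at h; omega
  · have h2 : Δ % 2 = 1 := by unfold Int.ModEq at h; omega
    rw [h2]; unfold Int.ModEq at h; omega

theorem isPrimitive_principalForm : (principalForm Δ).IsPrimitive := by
  rw [BinForm.IsPrimitive, Ideal.eq_top_iff_one]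
  exact Ideal.subset_span (by simp [principalForm])

theorem disc_principalForm : (principalForm Δ).disc = Δ := by
  have := four_mul_par (Δ := Δ)
  simp only [BinForm.disc, principalForm]
  linarith

instance : NoZeroDivisors (QuadOrder Δ) where
  eq_zero_or_eq_zero_of_mul_eq_zero {z w} h := by
    have key : ∀ z : QuadOrder Δ, z.norm = 0 → z = 0 := by
      intro z hz
      rw [QuadraticAlgebra.norm_def] at hz
      have h4 := four_mul_par (Δ := Δ)
      have hneg := hΔ.neg
      have h5 : (2 * z.re - parity Δ * z.im) ^ 2 + (-Δ) * z.im ^ 2 = 0 := by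
        linear_combination 4 * hz + z.im ^ 2 * h4
      have h6 : z.im = 0 := by
        by_contra h0
        have : 0 < z.im ^ 2 := by positivity
        nlinarith [sq_nonneg (2 * z.re - parity Δ * z.im)]
      have h7 : z.re = 0 := by
        rw [h6] at h5
        have : z.re ^ 2 = 0 := by linarith
        exact pow_eq_zero_iff (two_ne_zero) |>.1 this
      exact QuadraticAlgebra.ext h7 h6
    have := congrArg QuadraticAlgebra.norm h
    rw [map_mul, QuadraticAlgebra.norm_zero] at this
    exact (mul_eq_zero.1 this).imp (key z) (key w)

instance : IsDomain (QuadOrder Δ) := NoZeroDivisors.to_isDomain _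

/-- The ideal `⟨ω + (π - b) / 2, a⟩` attached to the form `[a, b, c]`. -/
def formIdeal (q : PrimForm ℤ Δ) : Ideal (QuadOrder Δ) :=
  Ideal.span {QuadraticAlgebra.omega + (((parity Δ - q.1.b) / 2 : ℤ) : QuadOrder Δ),
    ((q.1.a : ℤ) : QuadOrder Δ)}

theorem PrimForm.exists_shift (q : PrimForm ℤ Δ) :
    q.1.b = parity Δ - 2 * ((parity Δ - q.1.b) / 2) := by
  have h4 := four_mul_par (Δ := Δ)
  have hd : q.1.b ^ 2 - 4 * q.1.a * q.1.c = Δ := q.2.2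
  have h : 2 ∣ parity Δ - q.1.b := by
    have : (2 : ℤ) ∣ (parity Δ - q.1.b) ^ 2 :=
      ⟨2 * q.1.a * q.1.c + 2 * ((Δ - parity Δ ^ 2) / 4) + parity Δ ^ 2 - q.1.b * parity Δ, by
        linear_combination hd - h4⟩
    exact Int.prime_two.dvd_of_dvd_pow this
  have := Int.mul_ediv_cancel' h
  linarith

theorem PrimForm.mul_coeff (q : PrimForm ℤ Δ) {k : ℤ} (hk : q.1.b = parity Δ - 2 * k) :
    q.1.a * q.1.c = k ^ 2 - k * parity Δ - (Δ - parity Δ ^ 2) / 4 := by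
  have h4 := four_mul_par (Δ := Δ)
  have hd : q.1.b ^ 2 - 4 * q.1.a * q.1.c = Δ := q.2.2
  rw [hk] at hd
  have : 4 * (q.1.a * q.1.c) = 4 * (k ^ 2 - k * parity Δ - (Δ - parity Δ ^ 2) / 4) := by
    linear_combination -hd + h4
  linarith

theorem PrimForm.a_ne_zero (q : PrimForm ℤ Δ) : q.1.a ≠ 0 := by
  intro h
  have hd : q.1.b ^ 2 - 4 * q.1.a * q.1.c = Δ := q.2.2
  have := hΔ.neg
  rw [h] at hd
  nlinarith [sq_nonneg q.1.b]

theorem formIdeal_eq (q : PrimForm ℤ Δ) {k : ℤ} (hk : q.1.b = parity Δ - 2 * k) :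
    formIdeal q = Ideal.span {(⟨k, 1⟩ : QuadOrder Δ), ⟨q.1.a, 0⟩} := by
  have : (parity Δ - q.1.b) / 2 = k := by omega
  rw [formIdeal, this]
  congr 2
  · ext <;> simp
  
theorem mem_span_pair_iff {a k c : ℤ} (h : a * c = k ^ 2 - k * parity Δ - (Δ - parity Δ ^ 2) / 4)
    (z : QuadOrder Δ) :
    z ∈ Ideal.span {(⟨k, 1⟩ : QuadOrder Δ), ⟨a, 0⟩} ↔ a ∣ z.re - k * z.im := by
  constructor
  · intro hz
    obtain ⟨u, v, rfl⟩ := Ideal.mem_span_pair.1 hz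
    refine ⟨u.im * (-c) + v.re - k * v.im, ?_⟩
    simp only [QuadraticAlgebra.re_add, QuadraticAlgebra.re_mul, QuadraticAlgebra.im_add,
      QuadraticAlgebra.im_mul]
    linear_combination u.im * h
  · rintro ⟨m, hm⟩
    rw [Ideal.mem_span_pair]
    refine ⟨⟨z.im, 0⟩, ⟨m, 0⟩, ?_⟩
    ext
    · simp; linear_combination -hm
    · simp

theorem mem_formIdeal (q : PrimForm ℤ Δ) {k : ℤ} (hk : q.1.b = parity Δ - 2 * k)
    (z : QuadOrder Δ) : z ∈ formIdeal q ↔ q.1.a ∣ z.re - k * z.im := by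
  rw [formIdeal_eq q hk, mem_span_pair_iff (q.mul_coeff hk)]

open nonZeroDivisors

theorem isUnit_formIdeal (q : PrimForm ℤ Δ) :
    IsUnit ((formIdeal q : Ideal (QuadOrder Δ)) :
      FractionalIdeal (QuadOrder Δ)⁰ (FractionRing (QuadOrder Δ))) := by
  obtain ⟨k, hk⟩ : ∃ k, q.1.b = parity Δ - 2 * k := ⟨_, q.exists_shift⟩
  have hac := q.mul_coeff hk
  have hprim : (1 : ℤ) ∈ Ideal.span {q.1.a, q.1.b, q.1.c} := by
    rw [show Ideal.span {q.1.a, q.1.b, q.1.c} = ⊤ from q.2.1]; trivial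
  obtain ⟨r, s, t, hrst⟩ := Submodule.mem_span_triple.1 hprim
  simp only [smul_eq_mul] at hrst
  have hprod : formIdeal q * Ideal.span {(⟨k - parity Δ, -1⟩ : QuadOrder Δ), ⟨q.1.a, 0⟩} =
      Ideal.span {(⟨q.1.a, 0⟩ : QuadOrder Δ)} := by
    rw [formIdeal_eq q hk, Ideal.span_pair_mul_span_pair]
    apply le_antisymm
    · rw [Ideal.span_le]
      rintro z (rfl | rfl | rfl | rfl) <;>
        rw [SetLike.mem_coe, Ideal.mem_span_singleton]
      · refine ⟨⟨q.1.c, 0⟩, ?_⟩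
        ext
        · simp; linear_combination -hac
        · simp; ring
      · exact ⟨⟨k, 1⟩, by ext <;> simp [mul_comm]⟩
      · exact ⟨⟨k - parity Δ, -1⟩, by ext <;> simp⟩
      · exact ⟨⟨q.1.a, 0⟩, rfl⟩
    · rw [Ideal.span_singleton_le_iff_mem]
      have e : (⟨q.1.a, 0⟩ : QuadOrder Δ) =
          ⟨t, 0⟩ * (⟨k, 1⟩ * ⟨k - parity Δ, -1⟩) + (⟨-s, 0⟩ * (⟨k, 1⟩ * ⟨q.1.a, 0⟩) +
          (⟨-s, 0⟩ * (⟨q.1.a, 0⟩ * ⟨k - parity Δ, -1⟩) + ⟨r, 0⟩ * (⟨q.1.a, 0⟩ * ⟨q.1.a, 0⟩))) := by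
        ext
        · simp; linear_combination (-q.1.a) * hrst + t * hac + s * q.1.a * hk
        · simp; right; ring
      have m1 := Ideal.subset_span (s := {(⟨k, 1⟩ * ⟨k - parity Δ, -1⟩ : QuadOrder Δ),
        ⟨k, 1⟩ * ⟨q.1.a, 0⟩, ⟨q.1.a, 0⟩ * ⟨k - parity Δ, -1⟩, ⟨q.1.a, 0⟩ * ⟨q.1.a, 0⟩})
      have hmem := add_mem (Ideal.mul_mem_left _ ⟨t, 0⟩ (m1 (Or.inl rfl)))
        (add_mem (Ideal.mul_mem_left _ ⟨-s, 0⟩ (m1 (Or.inr (Or.inl rfl))))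
        (add_mem (Ideal.mul_mem_left _ ⟨-s, 0⟩ (m1 (Or.inr (Or.inr (Or.inl rfl)))))
        (Ideal.mul_mem_left _ ⟨r, 0⟩ (m1 (Or.inr (Or.inr (Or.inr rfl)))))))
      rwa [← e] at hmem
  have hu : IsUnit ((Ideal.span {(⟨q.1.a, 0⟩ : QuadOrder Δ)} : Ideal (QuadOrder Δ)) :
      FractionalIdeal (QuadOrder Δ)⁰ (FractionRing (QuadOrder Δ))) := by
    rw [FractionalIdeal.coeIdeal_span_singleton]
    have hne : algebraMap (QuadOrder Δ) (FractionRing (QuadOrder Δ)) ⟨q.1.a, 0⟩ ≠ 0 := by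
      rw [Ne, IsFractionRing.to_map_eq_zero_iff]
      intro h
      exact q.a_ne_zero (congrArg QuadraticAlgebra.re h)
    refine IsUnit.of_mul_eq_one (FractionalIdeal.spanSingleton _
      (algebraMap (QuadOrder Δ) (FractionRing (QuadOrder Δ)) ⟨q.1.a, 0⟩)⁻¹) ?_
    rw [FractionalIdeal.spanSingleton_mul_spanSingleton, mul_inv_cancel₀ hne,
      FractionalIdeal.spanSingleton_one]
  rw [← hprod, FractionalIdeal.coeIdeal_mul] at hu
  exact isUnit_of_mul_isUnit_left hu

/-- The class in `Pic` of the ideal attached to a form. -/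
noncomputable def formClass (q : PrimForm ℤ Δ) : ClassGroup (QuadOrder Δ) :=
  ClassGroup.mk (FractionRing (QuadOrder Δ)) (isUnit_formIdeal q).unit

theorem formClass_eq_iff (q q' : PrimForm ℤ Δ) : formClass q = formClass q' ↔
    ∃ x y : QuadOrder Δ, x ≠ 0 ∧ y ≠ 0 ∧
      Ideal.span {x} * formIdeal q = Ideal.span {y} * formIdeal q' :=
  ClassGroup.mk_eq_mk_of_coe_ideal rfl rfl

theorem sq_det_inv (M : GL (Fin 2) ℤ) :
    ∃ d : ℤ, d * d = 1 ∧ M 0 0 * M 1 1 - M 0 1 * M 1 0 = d ∧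
      (((Matrix.GeneralLinearGroup.det M)⁻¹ : ℤˣ) : ℤ) = d := by
  refine ⟨_, ?_, ?_, rfl⟩
  · rw [← Units.val_mul, Int.units_mul_self, Units.val_one]
  · rw [Int.units_inv_eq_self, Matrix.GeneralLinearGroup.val_det_apply, Matrix.det_fin_two]

theorem formClass_eq_of_equiv {q q' : PrimForm ℤ Δ} (h : (twSetoid ℤ Δ) q q') :
    formClass q = formClass q' := by
  obtain ⟨M, hM⟩ := h
  obtain ⟨k, hk⟩ : ∃ k, q.1.b = parity Δ - 2 * k := ⟨_, q.exists_shift⟩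
  obtain ⟨k', hk'⟩ : ∃ k, q'.1.b = parity Δ - 2 * k := ⟨_, q'.exists_shift⟩
  obtain ⟨d, hd1, hd, hd2⟩ := sq_det_inv M
  have ha0 := q.a_ne_zero
  have ha0' := q'.a_ne_zero
  have hac := q.mul_coeff hk
  have ha := congrArg BinForm.a hM
  have hb := congrArg BinForm.b hM
  simp only [BinForm.twist, hd2, BinForm.eval] at ha hb
  have hd0 : d ≠ 0 := by rintro rfl; simp at hd1
  rw [formClass_eq_iff]
  generalize hα : M 0 0 = α at *
  generalize hβ : M 0 1 = β at *
  generalize hγ : M 1 0 = γ at *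
  generalize hδ : M 1 1 = δ at *
  have e1 : (⟨q.1.a * α - (k - parity Δ) * γ, γ⟩ : QuadOrder Δ) * ⟨q.1.a * α - k * γ, -γ⟩ =
      ⟨q.1.a * d, 0⟩ * ⟨q'.1.a, 0⟩ := by
    ext
    · simp only [QuadraticAlgebra.re_mul]
      linear_combination (-q.1.a * d) * ha -
        q.1.a * (q.1.a * α ^ 2 + q.1.b * α * γ + q.1.c * γ ^ 2) * hd1 -
        q.1.a * α * γ * hk - γ ^ 2 * hac
    · simp only [QuadraticAlgebra.im_mul]
      ring
  have e2 : (⟨q.1.a * α - (k - parity Δ) * γ, γ⟩ : QuadOrder Δ) * ⟨q.1.a * β - k * δ, -δ⟩ =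
      ⟨q.1.a * d, 0⟩ * ⟨-k', -1⟩ := by
    ext
    · simp only [QuadraticAlgebra.re_mul]
      apply mul_left_cancel₀ (two_ne_zero (α := ℤ))
      linear_combination (-q.1.a * α * δ - q.1.a * β * γ) * hk - 2 * γ * δ * hac -
        q.1.a * d * hb - q.1.a * (2 * q.1.a * α * β + q.1.b * (α * δ + β * γ) +
        2 * q.1.c * γ * δ) * hd1 - parity Δ * q.1.a * hd + q.1.a * d * hk'
    · simp only [QuadraticAlgebra.im_mul]
      linear_combination (-q.1.a) * hd
  have hy0 : (⟨q.1.a * d, 0⟩ : QuadOrder Δ) ≠ 0 := fun h =>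
    mul_ne_zero ha0 hd0 (congrArg QuadraticAlgebra.re h)
  have ha'0 : (⟨q'.1.a, 0⟩ : QuadOrder Δ) ≠ 0 := fun h => ha0' (congrArg QuadraticAlgebra.re h)
  refine ⟨⟨q.1.a * α - (k - parity Δ) * γ, γ⟩, ⟨q.1.a * d, 0⟩, ?_, hy0, ?_⟩
  · intro h
    rw [h, zero_mul] at e1
    exact mul_ne_zero hy0 ha'0 e1.symm
  apply le_antisymm
  · rw [Ideal.span_singleton_mul_le_span_singleton_mul]
    intro z hz
    obtain ⟨m, hm⟩ := (mem_formIdeal q hk z).1 hz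
    refine ⟨⟨d * (m * δ + z.im * β), 0⟩ * ⟨q'.1.a, 0⟩ - ⟨d * (m * γ + z.im * α), 0⟩ * ⟨-k', -1⟩,
      ?_, ?_⟩
    · rw [mem_formIdeal q' hk']
      exact ⟨d * (m * δ + z.im * β), by simp; ring⟩
    · have hz' : z = ⟨d * (m * δ + z.im * β), 0⟩ * ⟨q.1.a * α - k * γ, -γ⟩ -
          ⟨d * (m * γ + z.im * α), 0⟩ * ⟨q.1.a * β - k * δ, -δ⟩ := by
        ext
        · simp only [QuadraticAlgebra.re_mul, QuadraticAlgebra.re_sub]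
          linear_combination hm - (q.1.a * m + k * z.im) * hd1 - d * (q.1.a * m + k * z.im) * hd
        · simp only [QuadraticAlgebra.im_mul, QuadraticAlgebra.im_sub]
          linear_combination - z.im * hd1 - d * z.im * hd
      linear_combination (⟨q.1.a * α - (k - parity Δ) * γ, γ⟩ : QuadOrder Δ) * hz' +
        (⟨d * (m * δ + z.im * β), 0⟩ : QuadOrder Δ) * e1 -
        (⟨d * (m * γ + z.im * α), 0⟩ : QuadOrder Δ) * e2
  · rw [Ideal.span_singleton_mul_le_span_singleton_mul]
    intro z hz
    obtain ⟨m, hm⟩ := (mem_formIdeal q' hk' z).1 hz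
    refine ⟨⟨m, 0⟩ * ⟨q.1.a * α - k * γ, -γ⟩ - ⟨z.im, 0⟩ * ⟨q.1.a * β - k * δ, -δ⟩, ?_, ?_⟩
    · rw [mem_formIdeal q hk]
      exact ⟨m * α - z.im * β, by simp; ring⟩
    · have hz' : z = ⟨m, 0⟩ * ⟨q'.1.a, 0⟩ - ⟨z.im, 0⟩ * ⟨-k', -1⟩ := by
        ext
        · simp only [QuadraticAlgebra.re_mul, QuadraticAlgebra.re_sub]
          linear_combination hm
        · simp only [QuadraticAlgebra.im_mul, QuadraticAlgebra.im_sub]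
          ring
      linear_combination (⟨q.1.a * d, 0⟩ : QuadOrder Δ) * hz' - (⟨m, 0⟩ : QuadOrder Δ) * e1 +
        (⟨z.im, 0⟩ : QuadOrder Δ) * e2

theorem equiv_of_formClass_eq {q q' : PrimForm ℤ Δ} (h : formClass q = formClass q') :
    (twSetoid ℤ Δ) q q' := by
  obtain ⟨k, hk⟩ : ∃ k, q.1.b = parity Δ - 2 * k := ⟨_, q.exists_shift⟩
  obtain ⟨k', hk'⟩ : ∃ k, q'.1.b = parity Δ - 2 * k := ⟨_, q'.exists_shift⟩
  have hac := q.mul_coeff hk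
  have hac' := q'.mul_coeff hk'
  have ha0 := q.a_ne_zero
  have ha0' := q'.a_ne_zero
  obtain ⟨x, y, hx, hy, hxy⟩ := (formClass_eq_iff q q').1 h
  have key : ∀ (q q' : PrimForm ℤ Δ) (k : ℤ) (_ : q.1.b = parity Δ - 2 * k) (x y : QuadOrder Δ)
      (_ : Ideal.span {x} * formIdeal q = Ideal.span {y} * formIdeal q') (w : QuadOrder Δ)
      (_ : w ∈ formIdeal q'), ∃ m n : ℤ, y * w = x * ⟨q.1.a * m - k * n, -n⟩ := by
    intro q q' k hk x y hxy w hw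
    obtain ⟨z, hz, h⟩ := Ideal.span_singleton_mul_le_span_singleton_mul.1 hxy.ge w hw
    obtain ⟨m, hm⟩ := (mem_formIdeal q hk z).1 hz
    refine ⟨m, -z.im, ?_⟩
    rw [h]
    congr 1
    ext
    · simp only; linear_combination hm
    · simp
  obtain ⟨α, γ, h1⟩ := key q q' k hk x y hxy ⟨q'.1.a, 0⟩ (by simp [mem_formIdeal q' hk'])
  obtain ⟨β, δ, h2⟩ := key q q' k hk x y hxy ⟨-k', -1⟩ (by simp [mem_formIdeal q' hk'])
  obtain ⟨α', γ', h3⟩ := key q' q k' hk' y x hxy.symm ⟨q.1.a, 0⟩ (by simp [mem_formIdeal q hk])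
  obtain ⟨β', δ', h4⟩ := key q' q k' hk' y x hxy.symm ⟨-k, -1⟩ (by simp [mem_formIdeal q hk])
  have h5 : (⟨q.1.a, 0⟩ : QuadOrder Δ) =
      ⟨α', 0⟩ * ⟨q.1.a * α - k * γ, -γ⟩ + ⟨γ', 0⟩ * ⟨q.1.a * β - k * δ, -δ⟩ := by
    apply mul_left_cancel₀ hx
    rw [h3, mul_add, mul_left_comm, ← h1, mul_left_comm x, ← h2, mul_left_comm, mul_left_comm _ y,
      ← mul_add]
    congr 1
    ext
    · simp only [QuadraticAlgebra.re_mul, QuadraticAlgebra.re_add]; ring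
    · simp only [QuadraticAlgebra.im_mul, QuadraticAlgebra.im_add]; ring
  have h6 : (⟨-k, -1⟩ : QuadOrder Δ) =
      ⟨β', 0⟩ * ⟨q.1.a * α - k * γ, -γ⟩ + ⟨δ', 0⟩ * ⟨q.1.a * β - k * δ, -δ⟩ := by
    apply mul_left_cancel₀ hx
    rw [h4, mul_add, mul_left_comm, ← h1, mul_left_comm x, ← h2, mul_left_comm, mul_left_comm _ y,
      ← mul_add]
    congr 1
    ext
    · simp only [QuadraticAlgebra.re_mul, QuadraticAlgebra.re_add]; ring
    · simp only [QuadraticAlgebra.im_mul, QuadraticAlgebra.im_add]; ring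
  have h5i := congrArg QuadraticAlgebra.im h5
  have h5r := congrArg QuadraticAlgebra.re h5
  have h6i := congrArg QuadraticAlgebra.im h6
  have h6r := congrArg QuadraticAlgebra.re h6
  simp only [QuadraticAlgebra.re_mul, QuadraticAlgebra.re_add, QuadraticAlgebra.im_mul,
    QuadraticAlgebra.im_add] at h5i h5r h6i h6r
  have g1 : α' * γ + γ' * δ = 0 := by linarith
  have g2 : α' * α + γ' * β = 1 := by
    apply mul_left_cancel₀ ha0
    linear_combination -h5r + k * g1
  have g3 : β' * γ + δ' * δ = 1 := by linarith
  have g4 : β' * α + δ' * β = 0 := by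
    apply mul_left_cancel₀ ha0
    linear_combination -h6r + k * g3
  have hdet : (α * δ - β * γ) * (α' * δ' - γ' * β') = 1 := by
    linear_combination g2 * (β' * γ + δ' * δ) + g3 - g4 * (α' * γ + γ' * δ)
  have hcross : (⟨q'.1.a, 0⟩ : QuadOrder Δ) * ⟨q.1.a * β - k * δ, -δ⟩ =
      ⟨q.1.a * α - k * γ, -γ⟩ * ⟨-k', -1⟩ := by
    apply mul_left_cancel₀ (mul_ne_zero hx hy)
    linear_combination (x * ⟨q.1.a * β - k * δ, -δ⟩) * h1 - (x * ⟨q.1.a * α - k * γ, -γ⟩) * h2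
  have hcross2 := congrArg (fun w => (⟨q.1.a * α - (k - parity Δ) * γ, γ⟩ : QuadOrder Δ) * w) hcross
  have hr := congrArg QuadraticAlgebra.re hcross2
  have hi := congrArg QuadraticAlgebra.im hcross2
  simp only [QuadraticAlgebra.re_mul, QuadraticAlgebra.im_mul] at hr hi
  obtain ⟨d, hd⟩ : ∃ d, d = α * δ - β * γ := ⟨_, rfl⟩
  have hdu : IsUnit d := by rw [hd]; exact IsUnit.of_mul_eq_one _ hdet
  have hdd : d * d = 1 := by
    rcases Int.isUnit_iff.1 hdu with h | h <;> rw [h] <;> norm_num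
  have hQ : q.1.a * α ^ 2 + q.1.b * α * γ + q.1.c * γ ^ 2 = d * q'.1.a := by
    apply mul_left_cancel₀ ha0
    linear_combination hi + q.1.a * α * γ * hk + γ ^ 2 * hac - q.1.a * q'.1.a * hd
  have hB : q'.1.b = d * (2 * q.1.a * α * β + q.1.b * (α * δ + β * γ) + 2 * q.1.c * γ * δ) := by
    have hP : (2 * q.1.a * α * β + q.1.b * (α * δ + β * γ) + 2 * q.1.c * γ * δ) =
        d * q'.1.b := by
      apply mul_left_cancel₀ (mul_ne_zero ha0 ha0')
      linear_combination 2 * hr - 2 * k' * (q.1.a * hQ - q.1.a * α * γ * hk - γ ^ 2 * hac) -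
        q.1.a * q'.1.a * parity Δ * hd + q'.1.a * (q.1.a * α * δ + q.1.a * β * γ) * hk +
        2 * q'.1.a * γ * δ * hac - q.1.a * q'.1.a * d * hk'
    rw [hP]; linear_combination (-q'.1.b) * hdd
  have hA : q'.1.a = d * (q.1.a * α ^ 2 + q.1.b * α * γ + q.1.c * γ ^ 2) := by
    rw [hQ]; linear_combination (-q'.1.a) * hdd
  have hC : q'.1.c = d * (q.1.a * β ^ 2 + q.1.b * β * δ + q.1.c * δ ^ 2) := by
    have hD : q.1.b ^ 2 - 4 * q.1.a * q.1.c = Δ := q.2.2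
    have hD' : q'.1.b ^ 2 - 4 * q'.1.a * q'.1.c = Δ := q'.2.2
    apply mul_left_cancel₀ (mul_ne_zero (four_ne_zero (α := ℤ)) ha0')
    linear_combination -hD' + (q'.1.b + d * (2 * q.1.a * α * β + q.1.b * (α * δ + β * γ) + 2 * q.1.c * γ * δ)) * hB +
      (2 * q.1.a * α * β + q.1.b * (α * δ + β * γ) + 2 * q.1.c * γ * δ) ^ 2 * hdd +
      4 * (q.1.a * β ^ 2 + q.1.b * β * δ + q.1.c * δ ^ 2) * hQ +
      (α * δ - β * γ) ^ 2 * hD + Δ * (hdd - (d + α * δ - β * γ) * hd)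
  have hM : IsUnit (Matrix.det !![α, β; γ, δ]) := by
    rw [Matrix.det_fin_two_of, ← hd]; exact hdu
  refine ⟨Matrix.GeneralLinearGroup.mk'' !![α, β; γ, δ] hM, ?_⟩
  obtain ⟨e, -, he, he2⟩ := sq_det_inv (Matrix.GeneralLinearGroup.mk'' !![α, β; γ, δ] hM)
  have hed : e = d := by rw [← he, hd]; rfl
  rw [hed] at he2
  ext
  · simp only [BinForm.twist, he2]
    exact hA
  · simp only [BinForm.twist, he2]
    exact hB
  · simp only [BinForm.twist, he2]
    exact hC

theorem exists_formIdeal (N : Ideal (QuadOrder Δ)) (hN : IsUnit (N :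
      FractionalIdeal (QuadOrder Δ)⁰ (FractionRing (QuadOrder Δ)))) :
    ∃ (x : QuadOrder Δ) (q : PrimForm ℤ Δ), x ≠ 0 ∧ N = Ideal.span {x} * formIdeal q := by
  have hN0 : N ≠ ⊥ := by
    rintro rfl
    simp at hN
  -- a basis of `N` over `ℤ` in normal form
  obtain ⟨A, hA⟩ : ∃ A : ℤ, ∀ n : ℤ, (⟨n, 0⟩ : QuadOrder Δ) ∈ N ↔ A ∣ n := by
    let T : Ideal ℤ := N.comap (algebraMap ℤ (QuadOrder Δ))
    refine ⟨Submodule.IsPrincipal.generator T, fun n => ?_⟩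
    rw [← Submodule.IsPrincipal.mem_iff_generator_dvd T, Ideal.mem_comap]
    rfl
  obtain ⟨g, hg⟩ : ∃ g : ℤ, ∀ n : ℤ, (∃ z ∈ N, z.im = n) ↔ g ∣ n := by
    let S : Ideal ℤ :=
      { carrier := {n | ∃ z ∈ N, z.im = n}
        add_mem' := by
          rintro _ _ ⟨z, hz, rfl⟩ ⟨w, hw, rfl⟩
          exact ⟨z + w, N.add_mem hz hw, rfl⟩
        zero_mem' := ⟨0, N.zero_mem, rfl⟩
        smul_mem' := by
          rintro c _ ⟨z, hz, rfl⟩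
          exact ⟨⟨c, 0⟩ * z, N.mul_mem_left _ hz, by simp⟩ }
    refine ⟨Submodule.IsPrincipal.generator S, fun n => ?_⟩
    rw [← Submodule.IsPrincipal.mem_iff_generator_dvd S]
    rfl
  obtain ⟨z0, hz0, hz0g⟩ := (hg g).2 dvd_rfl
  have hA0 : A ≠ 0 := by
    obtain ⟨z, hz, hzne⟩ := Submodule.exists_mem_ne_zero_of_ne_bot hN0
    rintro rfl
    have h1 : (⟨z.norm, 0⟩ : QuadOrder Δ) ∈ N := by
      have := QuadraticAlgebra.algebraMap_norm_eq_mul_star z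
      have h2 : (⟨z.norm, 0⟩ : QuadOrder Δ) = z * star z := by rw [← this]; rfl
      rw [h2]
      exact N.mul_mem_right _ hz
    have h2 := zero_dvd_iff.1 ((hA _).1 h1)
    have h3 : z * star z = 0 := by
      rw [← QuadraticAlgebra.algebraMap_norm_eq_mul_star, h2, map_zero]
    rcases mul_eq_zero.1 h3 with h | h
    · exact hzne h
    · exact hzne (by rw [← star_star z, h, star_zero])
  obtain ⟨a, ha⟩ : g ∣ A := (hg A).1
    ⟨⟨0, 1⟩ * ⟨A, 0⟩, N.mul_mem_left _ ((hA A).2 dvd_rfl), by simp⟩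
  have hg0 : g ≠ 0 := by rintro rfl; simp at ha; exact hA0 ha
  have ha0 : a ≠ 0 := by rintro rfl; simp at ha; exact hA0 ha
  obtain ⟨k, hk⟩ : g ∣ z0.re := by
    have h1 : g ∣ z0.re + (-parity Δ) * z0.im := (hg _).1
      ⟨⟨0, 1⟩ * z0, N.mul_mem_left _ hz0, by simp⟩
    rw [hz0g] at h1
    exact (Int.dvd_add_left (Dvd.intro_left _ rfl)).1 h1
  have hmem : ∀ z, z ∈ N ↔ ∃ w : QuadOrder Δ, z = ⟨g, 0⟩ * w ∧ a ∣ w.re - k * w.im := by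
    intro z
    constructor
    · intro hz
      obtain ⟨n, hn⟩ := (hg z.im).1 ⟨z, hz, rfl⟩
      have h1 : (⟨z.re - n * z0.re, 0⟩ : QuadOrder Δ) ∈ N := by
        have : (⟨z.re - n * z0.re, 0⟩ : QuadOrder Δ) = z - ⟨n, 0⟩ * z0 := by
          ext
          · simp
          · simp [hn, hz0g, mul_comm]
        rw [this]
        exact N.sub_mem hz (N.mul_mem_left _ hz0)
      obtain ⟨m, hm⟩ := (hA _).1 h1
      refine ⟨⟨a * m + k * n, n⟩, ?_, ⟨m, by simp only; ring⟩⟩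
      ext
      · simp; rw [hk, ha] at hm; linear_combination hm
      · simp [hn]
    · rintro ⟨w, rfl, m, hm⟩
      have : (⟨g, 0⟩ * w : QuadOrder Δ) = ⟨m, 0⟩ * ⟨A, 0⟩ + ⟨w.im, 0⟩ * z0 := by
        ext
        · simp; rw [hk, ha]; linear_combination g * hm
        · simp [hz0g, mul_comm]
      rw [this]
      exact N.add_mem (N.mul_mem_left _ ((hA A).2 dvd_rfl)) (N.mul_mem_left _ hz0)
  obtain ⟨c, hc⟩ : a ∣ k ^ 2 - k * parity Δ - (Δ - parity Δ ^ 2) / 4 := by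
    have h1 : (⟨g, 0⟩ * ⟨k, 1⟩ : QuadOrder Δ) ∈ N := (hmem _).2 ⟨_, rfl, by simp⟩
    have h2 := N.mul_mem_left ⟨k - parity Δ, -1⟩ h1
    obtain ⟨w, hw, hd⟩ := (hmem _).1 h2
    have hw' : (⟨k - parity Δ, -1⟩ * ⟨k, 1⟩ : QuadOrder Δ) = w := by
      apply mul_left_cancel₀ (a := (⟨g, 0⟩ : QuadOrder Δ))
      · intro h; exact hg0 (congrArg QuadraticAlgebra.re h)
      · rw [← hw, mul_left_comm]
    rw [← hw'] at hd
    convert hd using 1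
    simp
    ring
  have hspan : N = Ideal.span {(⟨g, 0⟩ : QuadOrder Δ)} *
      Ideal.span {(⟨k, 1⟩ : QuadOrder Δ), ⟨a, 0⟩} := by
    ext z
    rw [Ideal.mem_span_singleton_mul, hmem]
    constructor
    · rintro ⟨w, hw, hd⟩
      exact ⟨w, (mem_span_pair_iff hc.symm w).2 hd, hw.symm⟩
    · rintro ⟨w, hw, hd⟩
      exact ⟨w, hd.symm, (mem_span_pair_iff hc.symm w).1 hw⟩
  -- invertibility forces primitivity
  have hunit := hN
  rw [hspan, FractionalIdeal.coeIdeal_mul] at hunit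
  have hIu := isUnit_of_mul_isUnit_right hunit
  obtain ⟨J, t, ht, hJ⟩ : ∃ (J : Ideal (QuadOrder Δ)) (t : QuadOrder Δ), t ≠ 0 ∧
      Ideal.span {(⟨k, 1⟩ : QuadOrder Δ), ⟨a, 0⟩} * J = Ideal.span {t} := by
    obtain ⟨u, hu⟩ := hIu
    obtain ⟨t, J, ht, hJ⟩ := FractionalIdeal.exists_eq_spanSingleton_mul
      ((u⁻¹ : (FractionalIdeal (QuadOrder Δ)⁰ (FractionRing (QuadOrder Δ)))ˣ) :
        FractionalIdeal (QuadOrder Δ)⁰ (FractionRing (QuadOrder Δ)))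
    have ht' : algebraMap (QuadOrder Δ) (FractionRing (QuadOrder Δ)) t ≠ 0 := by
      rwa [Ne, IsFractionRing.to_map_eq_zero_iff]
    refine ⟨J, t, ht, ?_⟩
    apply FractionalIdeal.coeIdeal_injective (K := FractionRing (QuadOrder Δ))
    have h1 := u.mul_inv
    beta_reduce
    rw [hJ, hu, mul_left_comm] at h1
    rw [FractionalIdeal.coeIdeal_mul, FractionalIdeal.coeIdeal_span_singleton]
    have h2 := congrArg (fun X => FractionalIdeal.spanSingleton (QuadOrder Δ)⁰
      (algebraMap (QuadOrder Δ) (FractionRing (QuadOrder Δ)) t) * X) h1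
    simp only [mul_one] at h2
    rw [← h2, ← mul_assoc, FractionalIdeal.spanSingleton_mul_spanSingleton, mul_inv_cancel₀ ht',
      FractionalIdeal.spanSingleton_one, one_mul]
  have hprim : (⟨a, parity Δ - 2 * k, c⟩ : BinForm ℤ).IsPrimitive := by
    let D : Ideal ℤ := Ideal.span {a, parity Δ - 2 * k, c}
    obtain ⟨d, hd⟩ : ∃ d, D = Ideal.span {d} :=
      ⟨_, (Ideal.span_singleton_generator D).symm⟩
    have hdvd : ∀ x ∈ D, d ∣ x := fun x hx => by
      rwa [hd, Ideal.mem_span_singleton] at hx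
    obtain ⟨a', ha'⟩ := hdvd a (Ideal.subset_span (by simp))
    obtain ⟨b', hb'⟩ := hdvd (parity Δ - 2 * k) (Ideal.subset_span (by simp))
    obtain ⟨c', hc'⟩ := hdvd c (Ideal.subset_span (by simp))
    have hle : Ideal.span {(⟨k, 1⟩ : QuadOrder Δ)} *
        Ideal.span {(⟨k, 1⟩ : QuadOrder Δ), ⟨a, 0⟩} ≤
        Ideal.span {(⟨d, 0⟩ : QuadOrder Δ)} * Ideal.span {(⟨k, 1⟩ : QuadOrder Δ), ⟨a, 0⟩} := by
      rw [Ideal.span_singleton_mul_le_span_singleton_mul]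
      intro z hz
      obtain ⟨m, hm⟩ := (mem_span_pair_iff hc.symm z).1 hz
      refine ⟨⟨k * (a' * m - b' * z.im) - a * c' * z.im, a' * m - b' * z.im⟩, ?_, ?_⟩
      · rw [mem_span_pair_iff hc.symm]
        exact ⟨-c' * z.im, by simp; ring⟩
      · ext
        · simp only [QuadraticAlgebra.re_mul]
          linear_combination k * hm + k * m * ha' - k * z.im * hb' - a * z.im * hc' - z.im * hc
        · simp only [QuadraticAlgebra.im_mul]
          linear_combination hm + m * ha' - z.im * hb'
    have hle2 := Ideal.mul_mono_left (K := J) hle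
    rw [mul_assoc, mul_assoc, hJ, Ideal.span_singleton_mul_span_singleton,
      Ideal.span_singleton_mul_span_singleton, Ideal.span_singleton_le_span_singleton] at hle2
    obtain ⟨s, hs⟩ := hle2
    have hs' : (⟨k, 1⟩ : QuadOrder Δ) = ⟨d, 0⟩ * s := by
      apply mul_right_cancel₀ ht
      rw [hs]; ring
    have := congrArg QuadraticAlgebra.im hs'
    simp at this
    have hD : D = ⊤ := by
      rw [hd, Ideal.span_singleton_eq_top]
      exact IsUnit.of_mul_eq_one _ this.symm
    exact hD
  have hdisc : (⟨a, parity Δ - 2 * k, c⟩ : BinForm ℤ).disc = Δ := by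
    have h4 := four_mul_par (Δ := Δ)
    simp only [BinForm.disc]
    linear_combination 4 * hc + h4
  refine ⟨⟨g, 0⟩, ⟨⟨a, parity Δ - 2 * k, c⟩, hprim, hdisc⟩, ?_, ?_⟩
  · intro h; exact hg0 (congrArg QuadraticAlgebra.re h)
  · rw [hspan, formIdeal_eq (k := k) _ rfl]

theorem formClass_surjective : Function.Surjective (formClass (Δ := Δ)) := by
  intro C
  refine ClassGroup.induction (FractionRing (QuadOrder Δ)) (fun I => ?_) C
  · have hnum := FractionalIdeal.isUnit_num.2 I.isUnit
    obtain ⟨x, q, hx, hq⟩ := exists_formIdeal _ hnum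
    refine ⟨q, ?_⟩
    have hden : algebraMap (QuadOrder Δ) (FractionRing (QuadOrder Δ)) I.1.den ≠ 0 :=
      IsFractionRing.to_map_ne_zero_of_mem_nonZeroDivisors (SetLike.coe_mem _)
    have h1 : ClassGroup.mk (FractionRing (QuadOrder Δ)) I =
        ClassGroup.mk (FractionRing (QuadOrder Δ)) hnum.unit := by
      rw [ClassGroup.mk_eq_mk]
      refine ⟨Units.mk0 _ hden, ?_⟩
      apply Units.ext
      rw [mul_comm, Units.val_mul, coe_toPrincipalIdeal, Units.val_mk0]
      exact FractionalIdeal.den_mul_self_eq_num' (QuadOrder Δ)⁰ (FractionRing (QuadOrder Δ)) I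
    rw [h1, formClass]
    refine (ClassGroup.mk_eq_mk_of_coe_ideal rfl rfl).2 ⟨x, 1, hx, one_ne_zero, ?_⟩
    rw [← hq, Ideal.span_singleton_one, Ideal.one_eq_top.symm, one_mul]

/-- The bijection `[a, b, c] ↦ ⟨ω + (π - b) / 2, a⟩` between classes of forms and ideal classes. -/
noncomputable def ClTw.equivClassGroup : ClTw ℤ Δ ≃ ClassGroup (QuadOrder Δ) :=
  Equiv.ofBijective (Quotient.lift formClass fun _ _ h => formClass_eq_of_equiv h)
    ⟨by
      rintro ⟨q⟩ ⟨q'⟩ h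
      exact Quotient.sound (equiv_of_formClass_eq h),
    fun C => by
      obtain ⟨q, hq⟩ := formClass_surjective C
      exact ⟨ClTw.mk q, hq⟩⟩

/-- The composition law on classes of forms, transported from the ideal class group. -/
noncomputable instance : CommGroup (ClTw ℤ Δ) := ClTw.equivClassGroup.commGroup

end Order

/-- The set of values of `q` in `(ℤ / Δ)ˣ`. -/
def val (Δ : ℤ) (q : BinForm ℤ) : Set (ZMod Δ.natAbs)ˣ :=
  {u | ∃ x y : ZMod Δ.natAbs, (q.map (Int.castRingHom (ZMod Δ.natAbs))).eval x y = u}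

/-- The set of values of a class: the union of the sets of values of its representatives. -/
def classVal {Δ : ℤ} (C : ClTw ℤ Δ) : Set (ZMod Δ.natAbs)ˣ :=
  {u | ∃ q : PrimForm ℤ Δ, ClTw.mk q = C ∧ u ∈ val Δ q.1}

/-- The set of values of the principal form, as a subgroup of `(ℤ / Δ)ˣ`. -/
def valSubgroup (Δ : ℤ) : Subgroup (ZMod Δ.natAbs)ˣ where
  carrier := val Δ (principalForm Δ)
  one_mem' := ⟨1, 0, by simp [principalForm, BinForm.map, BinForm.eval]⟩
  mul_mem' := by
    rintro u v ⟨x, y, h⟩ ⟨x', y', h'⟩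
    simp only [principalForm, BinForm.map, BinForm.eval, map_neg, map_one] at h h'
    refine ⟨x * x' + Int.castRingHom _ ((Δ - parity Δ ^ 2) / 4) * y * y',
      x * y' + x' * y + Int.castRingHom _ (parity Δ) * y * y', ?_⟩
    simp only [principalForm, BinForm.map, BinForm.eval, map_neg, map_one]
    rw [Units.val_mul, ← h, ← h']
    ring
  inv_mem' := by
    rintro u ⟨x, y, h⟩
    refine ⟨x * (u⁻¹ : (ZMod Δ.natAbs)ˣ), y * (u⁻¹ : (ZMod Δ.natAbs)ˣ), ?_⟩
    have h2 : ((u⁻¹ : (ZMod Δ.natAbs)ˣ) : ZMod Δ.natAbs) * u = 1 := u.inv_mul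
    simp only [BinForm.eval] at h ⊢
    linear_combination ((u⁻¹ : (ZMod Δ.natAbs)ˣ) : ZMod Δ.natAbs) ^ 2 * h +
      ((u⁻¹ : (ZMod Δ.natAbs)ˣ) : ZMod Δ.natAbs) * h2

/-- The subgroup `± Val_Δ(q₀)` of `(ℤ / Δ)ˣ`. -/
def pmValSubgroup (Δ : ℤ) : Subgroup (ZMod Δ.natAbs)ˣ where
  carrier := {u | u ∈ valSubgroup Δ ∨ -u ∈ valSubgroup Δ}
  one_mem' := Or.inl (one_mem _)
  mul_mem' := by
    rintro u v (hu | hu) (hv | hv)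
    · exact Or.inl (mul_mem hu hv)
    · exact Or.inr (by simpa using mul_mem hu hv)
    · exact Or.inr (by simpa using mul_mem hu hv)
    · exact Or.inl (by simpa using mul_mem hu hv)
  inv_mem' := by
    rintro u (hu | hu)
    · exact Or.inl (inv_mem hu)
    · exact Or.inr (by simpa using inv_mem hu)

/-- A positive odd representative of a unit modulo `n`. -/
def oddRep {n : ℕ} (u : (ZMod n)ˣ) : ℕ :=
  if u.val.val % 2 = 1 then u.val.val else u.val.val + n

section Character

set_option linter.unusedSectionVars false

open NumberTheorySymbols

variable {Δ : ℤ} [hΔ : NegDisc Δ]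

theorem jacobiSym_congr {m n : ℕ} (hm : Odd m) (hn : Odd n)
    (h : (m : ZMod Δ.natAbs) = n) : J(Δ | m) = J(Δ | n) := by
  rw [ZMod.natCast_eq_natCast_iff] at h
  rcases hΔ.mod_four with h4 | h4
  · have h4' : Δ % 4 = 0 := h4
    rw [← jacobiSym.div_four_left h4' (Nat.odd_iff.1 hm),
      ← jacobiSym.div_four_left h4' (Nat.odd_iff.1 hn), jacobiSym.mod_right _ hm,
      jacobiSym.mod_right _ hn]
    have : 4 * (Δ / 4).natAbs = Δ.natAbs := by omega
    rw [this, h]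
  · have h4' : Δ % 4 = 1 := h4
    have key : ∀ m : ℕ, Odd m → J(Δ | m) = J(m | Δ.natAbs) := by
      intro m hm
      have hneg := hΔ.neg
      have hD : Δ.natAbs % 4 = 3 := by omega
      have e : Δ = -1 * (Δ.natAbs : ℤ) := by omega
      conv_lhs => rw [e]
      rw [jacobiSym.mul_left, jacobiSym.at_neg_one hm]
      rcases Nat.odd_mod_four_iff.1 (Nat.odd_iff.1 hm) with h1 | h3
      · rw [ZMod.χ₄_nat_one_mod_four h1, one_mul,
          jacobiSym.quadratic_reciprocity_one_mod_four h1 (Nat.odd_iff.2 (by omega))]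
      · rw [ZMod.χ₄_nat_three_mod_four h3,
          jacobiSym.quadratic_reciprocity_three_mod_four hD h3]
        ring
    rw [key m hm, key n hn]
    exact jacobiSym.mod_left' (by exact_mod_cast h)

instance : NeZero Δ.natAbs := ⟨by have := hΔ.neg; omega⟩

theorem oddRep_odd (u : (ZMod Δ.natAbs)ˣ) : Odd (oddRep u) := by
  unfold oddRep
  split_ifs with h
  · exact Nat.odd_iff.2 h
  · have hcop := ZMod.val_coe_unit_coprime u
    rw [Nat.odd_iff]
    by_contra h2
    have h3 : 2 ∣ Nat.gcd u.val.val Δ.natAbs := Nat.dvd_gcd (by omega) (by omega)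
    rw [hcop] at h3
    omega

theorem oddRep_cast (u : (ZMod Δ.natAbs)ˣ) : (oddRep u : ZMod Δ.natAbs) = u := by
  unfold oddRep
  split_ifs with h <;> simp

/-- The Dirichlet character `χ` modulo `Δ`, with `χ(p) = (Δ / p)` for odd primes `p ∤ Δ`:
the Jacobi symbol `(Δ / m)` at a positive odd representative `m` of the residue class. -/
def discChar (Δ : ℤ) [NegDisc Δ] : (ZMod Δ.natAbs)ˣ →* ℤˣ :=
  MonoidHom.toHomUnits
    { toFun := fun u => J(Δ | oddRep u)
      map_one' := by
        rw [jacobiSym_congr (oddRep_odd 1) odd_one (by rw [oddRep_cast]; simp),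
          jacobiSym.one_right]
      map_mul' := fun u v => by
        rw [← jacobiSym.mul_right' Δ (oddRep_odd u).pos.ne' (oddRep_odd v).pos.ne']
        exact jacobiSym_congr (oddRep_odd _) ((oddRep_odd u).mul (oddRep_odd v))
          (by push_cast; simp only [oddRep_cast, Units.val_mul]) }

theorem discChar_prime (p : ℕ) [hp : Fact p.Prime] (hp2 : p ≠ 2) (hpΔ : p.Coprime Δ.natAbs) :
    (discChar Δ (ZMod.unitOfCoprime p hpΔ) : ℤ) = legendreSym p Δ := by
  rw [jacobiSym.legendreSym.to_jacobiSym]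
  exact jacobiSym_congr (oddRep_odd _) (hp.1.odd_of_ne_two hp2) (by rw [oddRep_cast]; simp)

theorem discChar_unique (χ : (ZMod Δ.natAbs)ˣ →* ℤˣ)
    (h : ∀ (p : ℕ) [Fact p.Prime] (_ : p ≠ 2) (hpΔ : p.Coprime Δ.natAbs),
      (χ (ZMod.unitOfCoprime p hpΔ) : ℤ) = legendreSym p Δ) : χ = discChar Δ := by
  ext u
  obtain ⟨p, hp2, hp, hpu⟩ := Nat.forall_exists_prime_gt_and_eq_mod u.isUnit 2
  have : Fact p.Prime := ⟨hp⟩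
  have hc : p.Coprime Δ.natAbs := (ZMod.isUnit_iff_coprime p _).1 (hpu ▸ u.isUnit)
  have hu : u = ZMod.unitOfCoprime p hc := Units.ext (by simp [hpu])
  rw [hu, h p (by omega) hc, discChar_prime p (by omega) hc]

end Character

/-- The map `φ : ker χ / Val_Δ(q₀) → (ℤ / Δ)ˣ / ± Val_Δ(q₀)` induced by the inclusion of `ker χ`. -/
def phi (Δ : ℤ) [NegDisc Δ] :
    (discChar Δ).ker ⧸ (valSubgroup Δ).subgroupOf (discChar Δ).ker →*
      (ZMod Δ.natAbs)ˣ ⧸ pmValSubgroup Δ :=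
  QuotientGroup.map _ _ (discChar Δ).ker.subtype fun _ hu => Or.inl hu

/-- `ψ` sends each class of forms to its set of values, seen as a coset of `± Val_Δ(q₀)`. -/
def IsGenusHom {Δ : ℤ} [NegDisc Δ] (ψ : ClTw ℤ Δ →* (ZMod Δ.natAbs)ˣ ⧸ pmValSubgroup Δ) : Prop :=
  ∀ C : ClTw ℤ Δ, {u : (ZMod Δ.natAbs)ˣ | (u : (ZMod Δ.natAbs)ˣ ⧸ pmValSubgroup Δ) = ψ C} =
    classVal C

end GenusTheory

open GenusTheory

/-! If the leading coefficient `a` of `q` is prime to Δ, the identity a q(x, y) = q₀(ax − ky, y),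
with b = π − 2k, makes Val(q) the coset a⁻¹ Val(q₀) (`mem_val_iff_mul_mem_valSubgroup`). Unit
squares lie in Val(q₀), so this is a Val(q₀). Matrices of determinant −1 add the sign, and H_C is
the class of `a` (`mem_classVal_iff`). Multiplicativity is Dirichlet composition: for concordant
forms, ideals and leading coefficients multiply together (`exists_mk_mul_mk`).

Since 4q₀ = (2x + πy)² − Δy² is nonnegative, χ is trivial on Val(q₀), while Δ < 0 gives χ(−1) = −1.
So (ℤ/Δ)ˣ is ker χ times {±1}, which settles φ. It also reduces surjectivity of ψ to units in ker χ;
each of these contains a prime p modulo which Δ is a square, and such a p is a leading coefficient.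

Squares lie in ker ψ because the target has exponent 2. The converse is the deep part. A class of
trivial genus has a form with `a` positive, odd and prime to Δ, and χ(a) = 1 selects the sign: `a`
itself is a norm modulo Δ. As Δ is a square modulo `a`, a Legendre-type pigeonhole argument solves
N(γ) = a n² with n ≠ 0 (`exists_norm_eq_mul_sq`). Weak approximation on this conic then makes the
multiplier prime to Δ (`exists_norm_eq_mul_sq_isCoprime`). Hence the class contains some [m², b, c]
with m prime to Δ, which is the square of [m, b, mc] (`isSquare_mk_of_eq_sq`). -/

namespace GenusTheory

/-! ### The character χ on −1 and on values of the principal form -/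

section CharacterValues

set_option linter.unusedSectionVars false

open NumberTheorySymbols

variable {Δ : ℤ} [hΔ : NegDisc Δ]

theorem discChar_eq_jacobiSym {u : (ZMod Δ.natAbs)ˣ} {n : ℕ} (hn : Odd n)
    (h : (n : ZMod Δ.natAbs) = u) : (discChar Δ u : ℤ) = J(Δ | n) :=
  jacobiSym_congr (oddRep_odd u) hn (by rw [oddRep_cast, h])

theorem discChar_neg_one : discChar Δ (-1) = -1 := by
  have hneg := hΔ.neg
  obtain ⟨D, hD⟩ : ∃ D : ℕ, D = Δ.natAbs := ⟨_, rfl⟩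
  have hD0 : 0 < D := by omega
  -- The representative 4|Δ| − 1 of −1 is 3 modulo 4, and modulo it 4|Δ| is 1, so (Δ / ·) collapses
  -- to (−1 / ·).
  have hm : Odd (4 * D - 1) := Nat.odd_iff.2 (by omega)
  apply Units.ext
  rw [discChar_eq_jacobiSym hm]
  · have e : Δ = -1 * (D : ℤ) := by omega
    have h3 : (4 * D - 1) % 4 = 3 := by omega
    have h1 : J(4 * (D : ℤ) | 4 * D - 1) = 1 := by
      rw [← jacobiSym.one_left (4 * D - 1)]
      apply jacobiSym.mod_left'
      apply Int.ModEq.symm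
      rw [Int.modEq_iff_dvd]
      exact ⟨1, by push_cast [show 1 ≤ 4 * D by omega]; ring⟩
    have h4 : J(4 | 4 * D - 1) = 1 := by
      have : (4 : ℤ) = 2 ^ 2 := by norm_num
      rw [this]
      apply jacobiSym.sq_one'
      have : Nat.gcd 2 (4 * D - 1) = 1 := by
        rw [← Nat.coprime_iff_gcd_eq_one]
        exact (Nat.coprime_two_left).2 hm
      exact_mod_cast this
    rw [jacobiSym.mul_left, h4, one_mul] at h1
    rw [e, jacobiSym.mul_left, h1, jacobiSym.at_neg_one hm, ZMod.χ₄_nat_three_mod_four h3]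
    simp
  · rw [Nat.cast_sub (by omega), ← hD]
    simp

theorem discChar_neg (u : (ZMod Δ.natAbs)ˣ) : discChar Δ (-u) = -discChar Δ u := by
  rw [← neg_one_mul u, map_mul, discChar_neg_one, neg_one_mul]

/-- Modulo n, Δ is the square of b / y, and b is prime to n because b² ≡ Δy². -/
theorem jacobiSym_disc_eq_one_of_sq {n : ℕ} {b y : ℤ} (hy : IsCoprime y n)
    (hc : IsCoprime Δ n) (h : (n : ℤ) ∣ b ^ 2 - Δ * y ^ 2) : J(Δ | n) = 1 := by
  have hy1 : J(y ^ 2 | n) = 1 := jacobiSym.sq_one' (Int.isCoprime_iff_gcd_eq_one.1 hy)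
  have h1 : J(Δ * y ^ 2 | n) = J(b ^ 2 | n) :=
    jacobiSym.mod_left' (Int.modEq_iff_dvd.2 h)
  rw [jacobiSym.mul_left, hy1, mul_one] at h1
  rw [h1]
  apply jacobiSym.sq_one'
  rw [← Int.isCoprime_iff_gcd_eq_one]
  have h2 : IsCoprime (Δ * y ^ 2) (n : ℤ) := hc.mul_left hy.pow_left
  obtain ⟨t, ht⟩ := h
  rw [show Δ * y ^ 2 = b ^ 2 + (n : ℤ) * (-t) by linarith] at h2
  exact IsCoprime.of_isCoprime_of_dvd_left (IsCoprime.of_add_mul_left_left h2)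
    (dvd_pow_self b two_ne_zero)

theorem four_mul_eval_principalForm (x y : ℤ) :
    4 * (principalForm Δ).eval x y = (2 * x + parity Δ * y) ^ 2 - Δ * y ^ 2 := by
  have h4 := four_mul_par (Δ := Δ)
  simp only [principalForm, BinForm.eval]
  linear_combination (-y ^ 2) * h4

theorem eval_principalForm_nonneg (x y : ℤ) : 0 ≤ (principalForm Δ).eval x y := by
  have := four_mul_eval_principalForm (Δ := Δ) x y
  have := hΔ.neg
  nlinarith [sq_nonneg (2 * x + parity Δ * y), sq_nonneg y]

/-- Dividing x and y by their gcd g writes n = m g², and g² contributes a trivial symbol. For the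
primitive value, m ≡ x'² modulo y' shows that y' is prime to m, so 4m = (2x' + πy')² − Δy'² makes Δ
a square modulo m. -/
theorem jacobiSym_eval_principalForm {n : ℕ} (hn : IsCoprime Δ n) (hodd : Odd n) {x y : ℤ}
    (h : (principalForm Δ).eval x y = n) : J(Δ | n) = 1 := by
  have hn0 : (n : ℤ) ≠ 0 := by exact_mod_cast hodd.pos.ne'
  have hg0 : 0 < Int.gcd x y := by
    rw [Int.gcd_pos_iff]
    by_contra! h0
    rw [h0.1, h0.2] at h
    simp [BinForm.eval] at h
    exact hn0 (by exact_mod_cast h.symm)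
  obtain ⟨x', y', hxy, hx, hy⟩ := Int.exists_gcd_one hg0
  obtain ⟨g, hg⟩ : ∃ g, g = Int.gcd x y := ⟨_, rfl⟩
  rw [← hg] at hx hy hg0
  obtain ⟨m, hm⟩ := Int.eq_ofNat_of_zero_le (eval_principalForm_nonneg (Δ := Δ) x' y')
  have hnm : n = m * g ^ 2 := by
    zify
    rw [← h, ← hm, hx, hy]
    simp only [BinForm.eval]
    ring
  have hmn : (m : ℤ) ∣ n := ⟨g ^ 2, by exact_mod_cast hnm⟩
  have hgn : (g : ℤ) ∣ n := ⟨m * g, by rw [hnm]; push_cast; ring⟩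
  have hgΔ : IsCoprime Δ g := IsCoprime.of_isCoprime_of_dvd_right hn hgn
  have hmΔ : IsCoprime Δ m := IsCoprime.of_isCoprime_of_dvd_right hn hmn
  have hm0 : m ≠ 0 := by rintro rfl; simp at hnm; omega
  rw [hnm, jacobiSym.mul_right' _ hm0 (by positivity), jacobiSym.pow_right,
    jacobiSym.sq_one (Int.isCoprime_iff_gcd_eq_one.1 hgΔ), mul_one]
  have h4 := four_mul_eval_principalForm (Δ := Δ) x' y'
  rw [hm] at h4
  refine jacobiSym_disc_eq_one_of_sq (b := 2 * x' + parity Δ * y') (y := y') ?_ hmΔ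
    ⟨4, by rw [← h4]; ring⟩
  have hxy' : IsCoprime (x' ^ 2) y' := (Int.isCoprime_iff_gcd_eq_one.2 hxy).pow_left
  have : (m : ℤ) = x' ^ 2 + y' * (parity Δ * x' + (-((Δ - parity Δ ^ 2) / 4)) * y') := by
    rw [← show _ = (m : ℤ) from hm]
    simp only [BinForm.eval, principalForm]
    ring
  rw [this]
  exact (hxy'.add_mul_left_left _).symm

theorem intCast_natAbs_dvd {z w : ℤ} : (z : ZMod Δ.natAbs) = w ↔ Δ ∣ z - w := by
  rw [eq_comm, ZMod.intCast_eq_intCast_iff_dvd_sub, Int.natAbs_dvd]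

theorem isCoprime_of_cast_eq_unit {z : ℤ} {u : (ZMod Δ.natAbs)ˣ}
    (h : (z : ZMod Δ.natAbs) = u) : IsCoprime z Δ := by
  obtain ⟨w, hw⟩ := ZMod.intCast_surjective ((u⁻¹ : (ZMod Δ.natAbs)ˣ) : ZMod Δ.natAbs)
  have h1 : ((z * w : ℤ) : ZMod Δ.natAbs) = (1 : ℤ) := by
    push_cast
    rw [h, hw, Units.mul_inv]
  obtain ⟨t, ht⟩ := intCast_natAbs_dvd.1 h1
  exact ⟨w, -t, by linear_combination ht⟩

theorem exists_unit_of_isCoprime {z : ℤ} (h : IsCoprime z Δ) :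
    ∃ u : (ZMod Δ.natAbs)ˣ, (u : ZMod Δ.natAbs) = z := by
  obtain ⟨s, t, hst⟩ := h
  have h1 : (s : ZMod Δ.natAbs) * z = 1 := by
    have : ((s * z : ℤ) : ZMod Δ.natAbs) = (1 : ℤ) :=
      intCast_natAbs_dvd.2 ⟨-t, by linear_combination hst⟩
    simpa using this
  exact ⟨⟨z, s, by rw [mul_comm]; exact h1, h1⟩, rfl⟩

theorem map_eval_intCast (q : BinForm ℤ) (x y : ℤ) :
    (q.map (Int.castRingHom (ZMod Δ.natAbs))).eval x y = (q.eval x y : ℤ) := by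
  simp [BinForm.map, BinForm.eval]

theorem mem_val_iff {q : BinForm ℤ} {u : (ZMod Δ.natAbs)ˣ} :
    u ∈ val Δ q ↔ ∃ x y : ℤ, ((q.eval x y : ℤ) : ZMod Δ.natAbs) = u := by
  constructor
  · rintro ⟨x, y, h⟩
    obtain ⟨x, rfl⟩ := ZMod.intCast_surjective x
    obtain ⟨y, rfl⟩ := ZMod.intCast_surjective y
    exact ⟨x, y, by rw [← map_eval_intCast, h]⟩
  · rintro ⟨x, y, h⟩
    exact ⟨x, y, by rw [map_eval_intCast, h]⟩

theorem valSubgroup_le_ker_discChar : valSubgroup Δ ≤ (discChar Δ).ker := by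
  intro u hu
  obtain ⟨x, y, hxy⟩ := mem_val_iff.1 (show u ∈ val Δ (principalForm Δ) from hu)
  obtain ⟨x', y', hxy', hodd⟩ : ∃ x' y' : ℤ,
      (((principalForm Δ).eval x' y' : ℤ) : ZMod Δ.natAbs) = u ∧
        Odd ((principalForm Δ).eval x' y') := by
    rcases Int.even_or_odd Δ with he | ho
    · refine ⟨x, y, hxy, ?_⟩
      by_contra h
      have h2 := (isCoprime_of_cast_eq_unit hxy).isUnit_of_dvd'
        (even_iff_two_dvd.1 (Int.not_odd_iff_even.1 h)) (even_iff_two_dvd.1 he)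
      exact Int.prime_two.not_isUnit h2
    · have hcong : ∀ s t : ℤ, (((principalForm Δ).eval (x + s * Δ) (y + t * Δ) : ℤ) :
          ZMod Δ.natAbs) = u := by
        intro s t
        rw [← hxy, intCast_natAbs_dvd]
        refine ⟨2 * x * s + s ^ 2 * Δ + parity Δ * (x * t + s * y + s * t * Δ) +
          (-((Δ - parity Δ ^ 2) / 4)) * (2 * y * t + t ^ 2 * Δ), ?_⟩
        simp only [BinForm.eval, principalForm]
        ring
      -- For odd Δ these shifts make the first coordinate odd and the second even, whatever x and y
      -- are, so the value becomes odd.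
      refine ⟨x + (x + 1) * Δ, y + y * Δ, hcong _ _, ?_⟩
      have h1 : Odd (x + (x + 1) * Δ) := by
        rcases Int.even_or_odd x with h | h
        · exact h.add_odd (h.add_one.mul ho)
        · exact h.add_even (h.add_one.mul_right _)
      have h2 : Even (y + y * Δ) := by
        rw [show y + y * Δ = y * (1 + Δ) by ring]
        exact (odd_one.add_odd ho).mul_left _
      have e : (principalForm Δ).eval (x + (x + 1) * Δ) (y + y * Δ) = (x + (x + 1) * Δ) ^ 2 +
          (parity Δ * (x + (x + 1) * Δ) + (-((Δ - parity Δ ^ 2) / 4)) * (y + y * Δ)) *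
            (y + y * Δ) := by
        simp only [BinForm.eval, principalForm]
        ring
      rw [e]
      exact h1.pow.add_even (h2.mul_left _)
  obtain ⟨n, hn⟩ := Int.eq_ofNat_of_zero_le (eval_principalForm_nonneg (Δ := Δ) x' y')
  have hcop := isCoprime_of_cast_eq_unit hxy'
  rw [hn] at hxy' hodd hcop
  have hodd' : Odd n := by exact_mod_cast hodd
  rw [MonoidHom.mem_ker]
  apply Units.ext
  rw [discChar_eq_jacobiSym hodd' (by simpa using hxy'),
    jacobiSym_eval_principalForm hcop.symm hodd' hn, Units.val_one]

/-- As χ(−1) = −1, exactly one of u and −u lies in ker χ: "at most one" gives injectivity, "at least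
one" surjectivity. -/
theorem phi_bijective : Function.Bijective (phi Δ) := by
  have hle := valSubgroup_le_ker_discChar (Δ := Δ)
  constructor
  · rw [injective_iff_map_eq_one]
    intro x
    refine QuotientGroup.induction_on x fun u hu => ?_
    have hu' : ((u : (ZMod Δ.natAbs)ˣ) : (ZMod Δ.natAbs)ˣ ⧸ pmValSubgroup Δ) = 1 := hu
    rw [QuotientGroup.eq_one_iff] at hu' ⊢
    rw [Subgroup.mem_subgroupOf]
    rcases hu' with h | h
    · exact h
    · have h1 := MonoidHom.mem_ker.1 (hle h)
      rw [discChar_neg, MonoidHom.mem_ker.1 u.2] at h1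
      exact absurd h1 (by decide)
  · intro x
    refine QuotientGroup.induction_on x fun u => ?_
    rcases Int.units_eq_one_or (discChar Δ u) with h | h
    · exact ⟨((⟨u, h⟩ : (discChar Δ).ker) : _ ⧸ _), rfl⟩
    · have h1 : -u ∈ (discChar Δ).ker := by rw [MonoidHom.mem_ker, discChar_neg, h, neg_neg]
      refine ⟨((⟨-u, h1⟩ : (discChar Δ).ker) : _ ⧸ _), ?_⟩
      refine (QuotientGroup.eq (s := pmValSubgroup Δ)).2 (Or.inr ?_)
      simp [one_mem]

end CharacterValues

/-! ### Pigeonhole solution of a ternary equation, Hensel lifting, splitting of integers by primes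
-/

section Conic

theorem sq_sub_lt_of_mem_range {N M x x' : ℕ} (hN : ∀ x < N, x ^ 2 < M) (hx : x < N)
    (hx' : x' < N) : ((x : ℤ) - x') ^ 2 < M := by
  have h1 : (x : ℤ) ^ 2 < M := by exact_mod_cast hN x hx
  have h2 : (x' : ℤ) ^ 2 < M := by exact_mod_cast hN x' hx'
  rcases le_total x x' with h | h
  · have : (x : ℤ) ≤ x' := by exact_mod_cast h
    nlinarith
  · have : (x' : ℤ) ≤ x := by exact_mod_cast h
    nlinarith

theorem lt_sqrt_pred_add_one {M x : ℕ} (hM : 0 < M) (hx : x < Nat.sqrt (M - 1) + 1) :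
    x ^ 2 < M := by
  have : x ^ 2 ≤ M - 1 := Nat.le_sqrt'.1 (by omega)
  omega

theorem le_sqrt_pred_add_one_sq (M : ℕ) : M ≤ (Nat.sqrt (M - 1) + 1) ^ 2 := by
  have := Nat.lt_succ_sqrt' (M - 1)
  simp only [Nat.succ_eq_add_one] at this
  omega

/-- The bounds confine X² + dY² − aZ² strictly between −ad and 2ad, so it is 0 or ad. In the latter
case X² + dY² = a(Z² + d), and multiplying X + Y√−d by Z + √−d, of norm Z² + d, gives a solution. -/
theorem exists_sq_add_mul_sq_eq_mul_sq_of_dvd {a d X Y Z : ℤ} (ha : 0 < a) (hd : 0 < d)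
    (hX : X ^ 2 < a * d) (hY : Y ^ 2 < a) (hZ : Z ^ 2 < d) (hne : ¬ (X = 0 ∧ Y = 0 ∧ Z = 0))
    (hdvd : a * d ∣ X ^ 2 + d * Y ^ 2 - a * Z ^ 2) :
    ∃ X Y Z : ℤ, Z ≠ 0 ∧ X ^ 2 + d * Y ^ 2 = a * Z ^ 2 := by
  obtain ⟨w, hw⟩ := hdvd
  have had : 0 < a * d := mul_pos ha hd
  have hX0 := sq_nonneg X
  have hY0 : 0 ≤ d * Y ^ 2 := by positivity
  have hZ0 : 0 ≤ a * Z ^ 2 := by positivity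
  have hY1 : d * Y ^ 2 < d * a := mul_lt_mul_of_pos_left hY hd
  have hZ1 : a * Z ^ 2 < a * d := mul_lt_mul_of_pos_left hZ ha
  have hlo : -1 < w := lt_of_mul_lt_mul_left (a := a * d) (by linarith) had.le
  have hhi : w < 2 := lt_of_mul_lt_mul_left (a := a * d) (by linarith) had.le
  obtain rfl | rfl : w = 0 ∨ w = 1 := by omega
  · refine ⟨X, Y, Z, ?_, by linarith⟩
    rintro rfl
    have h1 : X ^ 2 = 0 := by linarith
    have h2 : d * Y ^ 2 = 0 := by linarith
    refine hne ⟨pow_eq_zero_iff two_ne_zero |>.1 h1, ?_, rfl⟩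
    exact pow_eq_zero_iff two_ne_zero |>.1 ((mul_eq_zero.1 h2).resolve_left hd.ne')
  · refine ⟨X * Z - d * Y, X + Y * Z, Z ^ 2 + d, by positivity, ?_⟩
    linear_combination (Z ^ 2 + d) * hw

/-- Solvability of `X² + d Y² = a Z²` when `-d` is a square modulo `a` and `a` is a square
modulo `d`. -/
theorem exists_sq_add_mul_sq_eq_mul_sq {a d : ℕ} (ha : 0 < a) (hd : 0 < d) (hc : Nat.Coprime a d)
    {r s : ℤ} (hr : (a : ℤ) ∣ r ^ 2 + d) (hs : (d : ℤ) ∣ s ^ 2 - a) :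
    ∃ X Y Z : ℤ, Z ≠ 0 ∧ X ^ 2 + d * Y ^ 2 = a * Z ^ 2 := by
  -- The box count needs one strict inequality. A nonsquare a supplies it as a < B², and a square a
  -- has an obvious solution.
  by_cases hsq : ∃ t : ℕ, t ^ 2 = a
  · obtain ⟨t, rfl⟩ := hsq
    exact ⟨t, 0, 1, one_ne_zero, by push_cast; ring⟩
  have : NeZero a := ⟨ha.ne'⟩
  have : NeZero d := ⟨hd.ne'⟩
  have had : 0 < a * d := Nat.mul_pos ha hd
  -- A, B, C are the rounded-up square roots of ad, a, d: coordinates below them have squares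
  -- strictly below ad, a, d.
  obtain ⟨A, hA⟩ : ∃ A, A = Nat.sqrt (a * d - 1) + 1 := ⟨_, rfl⟩
  obtain ⟨B, hB⟩ : ∃ B, B = Nat.sqrt (a - 1) + 1 := ⟨_, rfl⟩
  obtain ⟨C, hC⟩ : ∃ C, C = Nat.sqrt (d - 1) + 1 := ⟨_, rfl⟩
  have hA1 : ∀ x < A, x ^ 2 < a * d := fun x hx => lt_sqrt_pred_add_one had (hA ▸ hx)
  have hB1 : ∀ x < B, x ^ 2 < a := fun x hx => lt_sqrt_pred_add_one ha (hB ▸ hx)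
  have hC1 : ∀ x < C, x ^ 2 < d := fun x hx => lt_sqrt_pred_add_one hd (hC ▸ hx)
  have hA2 : a * d ≤ A ^ 2 := hA ▸ le_sqrt_pred_add_one_sq _
  have hB2 : a < B ^ 2 :=
    lt_of_le_of_ne (hB ▸ le_sqrt_pred_add_one_sq _) fun h => hsq ⟨B, h.symm⟩
  have hC2 : d ≤ C ^ 2 := hC ▸ le_sqrt_pred_add_one_sq _
  have hcard : a * d < A * (B * C) := by
    have h1 : a * d < B ^ 2 * C ^ 2 := Nat.mul_lt_mul_of_lt_of_le hB2 hC2 (hd.trans_le hC2)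
    have h2 : (a * d) * (a * d) < A ^ 2 * (B ^ 2 * C ^ 2) :=
      Nat.mul_lt_mul_of_le_of_lt hA2 h1 (had.trans_le hA2)
    have h3 : (a * d) ^ 2 < (A * (B * C)) ^ 2 := by
      calc (a * d) ^ 2 = (a * d) * (a * d) := by ring
        _ < _ := h2
        _ = _ := by ring
    exact lt_of_pow_lt_pow_left₀ 2 (Nat.zero_le _) h3
  -- The conditions X ≡ rY mod a and X ≡ sZ mod d force ad to divide the ternary form. They have ad
  -- residue classes, fewer than the box has points; a and d need not be squarefree.
  obtain ⟨⟨x, y, z⟩, hm, ⟨x', y', z'⟩, hm', hne, heq⟩ :=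
    Finset.exists_ne_map_eq_of_card_lt_of_maps_to
      (s := Finset.range A ×ˢ (Finset.range B ×ˢ Finset.range C))
      (t := (Finset.univ : Finset (ZMod a × ZMod d)))
      (f := fun v => ((v.1 : ZMod a) - r * v.2.1, (v.1 : ZMod d) - s * v.2.2))
      (by simpa [ZMod.card] using hcard) (fun _ _ => Finset.mem_coe.2 (Finset.mem_univ _))
  simp only [Finset.mem_product, Finset.mem_range] at hm hm'
  simp only [Prod.mk.injEq] at heq
  obtain ⟨X, hX⟩ : ∃ X : ℤ, X = (x : ℤ) - x' := ⟨_, rfl⟩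
  obtain ⟨Y, hY⟩ : ∃ Y : ℤ, Y = (y : ℤ) - y' := ⟨_, rfl⟩
  obtain ⟨Z, hZ⟩ : ∃ Z : ℤ, Z = (z : ℤ) - z' := ⟨_, rfl⟩
  have hX2 : X ^ 2 < a * d := by
    have := sq_sub_lt_of_mem_range hA1 hm.1 hm'.1
    rw [hX]; exact_mod_cast this
  have hY2 : Y ^ 2 < a := hY ▸ sq_sub_lt_of_mem_range hB1 hm.2.1 hm'.2.1
  have hZ2 : Z ^ 2 < d := hZ ▸ sq_sub_lt_of_mem_range hC1 hm.2.2 hm'.2.2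
  have hda : (a : ℤ) ∣ X - r * Y := by
    rw [← ZMod.intCast_zmod_eq_zero_iff_dvd, hX, hY]
    push_cast
    linear_combination heq.1
  have hdd : (d : ℤ) ∣ X - s * Z := by
    rw [← ZMod.intCast_zmod_eq_zero_iff_dvd, hX, hZ]
    push_cast
    linear_combination heq.2
  have hdvd : ((a : ℤ) * d) ∣ X ^ 2 + d * Y ^ 2 - a * Z ^ 2 := by
    apply IsCoprime.mul_dvd (Nat.isCoprime_iff_coprime.2 hc)
    · have : X ^ 2 + d * Y ^ 2 - a * Z ^ 2 =
          (X - r * Y) * (X + r * Y) + (r ^ 2 + d) * Y ^ 2 + a * (-Z ^ 2) := by ring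
      rw [this]
      exact ((hda.mul_right _).add (hr.mul_right _)).add (Dvd.intro _ rfl)
    · have : X ^ 2 + d * Y ^ 2 - a * Z ^ 2 =
          (X - s * Z) * (X + s * Z) + (s ^ 2 - a) * Z ^ 2 + d * Y ^ 2 := by ring
      rw [this]
      exact ((hdd.mul_right _).add (hs.mul_right _)).add (Dvd.intro _ rfl)
  refine exists_sq_add_mul_sq_eq_mul_sq_of_dvd (by exact_mod_cast ha) (by exact_mod_cast hd)
    hX2 hY2 hZ2 (fun ⟨hX0, hY0, hZ0⟩ => hne ?_) hdvd
  ext <;> simp only <;> omega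

/-- An integer congruent to `1` modulo `4d` is a square modulo every power of `d`. -/
theorem exists_sq_sub_dvd_pow {c d : ℤ} (hc : 4 * d ∣ 1 - c) (M : ℕ) :
    ∃ r : ℤ, d ^ M ∣ r ^ 2 - c := by
  -- Newton iteration. Carrying the factor 4 and correcting r by an even amount lets even d be
  -- treated like odd d.
  have key : ∀ k : ℕ, ∃ r : ℤ, IsCoprime r d ∧ 4 * d ^ (k + 1) ∣ r ^ 2 - c := by
    intro k
    induction k with
    | zero => exact ⟨1, isCoprime_one_left, by simpa using hc⟩
    | succ k ih =>
      obtain ⟨r, ⟨s, t, hst⟩, w, hw⟩ := ih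
      refine ⟨r + 2 * d ^ (k + 1) * (-s * w), ?_, w * t + d ^ k * (s * w) ^ 2, ?_⟩
      · rw [show r + 2 * d ^ (k + 1) * (-s * w) = r + d * (2 * d ^ k * (-s * w)) by ring]
        exact IsCoprime.add_mul_left_left ⟨s, t, hst⟩ _
      · linear_combination hw - 4 * d ^ (k + 1) * w * hst
  obtain ⟨r, -, h⟩ := key M
  exact ⟨r, ((pow_dvd_pow d M.le_succ).trans (Dvd.intro_left 4 rfl)).trans h⟩

/-- Sorting the prime powers of n by P. It serves to prescribe a sign at each prime of Δ. -/
theorem exists_coprime_factorization (P : ℕ → Prop) (n : ℕ) (hn : n ≠ 0) :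
    ∃ m m' : ℕ, n = m * m' ∧ m.Coprime m' ∧ (∀ p, p.Prime → p ∣ m → P p) ∧
      ∀ p, p.Prime → p ∣ m' → ¬ P p := by
  induction n using Nat.recOnPosPrimePosCoprime with
  | prime_pow p k hp hk =>
    have h : ∀ q, q.Prime → q ∣ p ^ k → q = p := fun q hq hd =>
      (Nat.prime_dvd_prime_iff_eq hq hp).1 (hq.dvd_of_dvd_pow hd)
    by_cases hP : P p
    · refine ⟨p ^ k, 1, by simp, by simp, fun q hq hd => h q hq hd ▸ hP, fun q hq hd => ?_⟩
      exact absurd (Nat.dvd_one.1 hd) hq.ne_one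
    · refine ⟨1, p ^ k, by simp, by simp, fun q hq hd => ?_, fun q hq hd => h q hq hd ▸ hP⟩
      exact absurd (Nat.dvd_one.1 hd) hq.ne_one
  | zero => exact absurd rfl hn
  | one =>
    exact ⟨1, 1, rfl, by simp, fun q hq hd => absurd (Nat.dvd_one.1 hd) hq.ne_one,
      fun q hq hd => absurd (Nat.dvd_one.1 hd) hq.ne_one⟩
  | coprime a b ha hb hab iha ihb =>
    obtain ⟨m, m', rfl, h1, h2, h3⟩ := iha (by omega)
    obtain ⟨k, k', rfl, h1', h2', h3'⟩ := ihb (by omega)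
    refine ⟨m * k, m' * k', by ring, ?_, fun p hp hd => ?_, fun p hp hd => ?_⟩
    · have h4 : m.Coprime k' := (hab.coprime_mul_right).coprime_mul_left_right
      have h5 : k.Coprime m' := ((hab.coprime_mul_left).coprime_mul_right_right).symm
      exact Nat.Coprime.mul_left (h1.mul_right h4) (h5.mul_right h1')
    · exact (hp.dvd_mul.1 hd).elim (h2 p hp) (h2' p hp)
    · exact (hp.dvd_mul.1 hd).elim (h3 p hp) (h3' p hp)

/-- If no `p ^ M` with `p` a prime divisor of `D` divides `T`, then `T` splits into a divisor of
`D ^ M` and a factor prime to `D`. -/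
theorem exists_mul_dvd_pow_isCoprime {T D : ℤ} {M : ℕ} (hD : D ≠ 0)
    (h : ∀ p : ℕ, p.Prime → (p : ℤ) ∣ D → ¬ (p : ℤ) ^ M ∣ T) :
    ∃ T₁ T₂ : ℤ, T = T₁ * T₂ ∧ T₁ ∣ D ^ M ∧ IsCoprime T₂ D := by
  -- If a prime p of D divided the cofactor of this gcd, one more power of p than the gcd contains
  -- would divide T and, by `h`, also D ^ M.
  obtain ⟨T₂, hT₂⟩ : (Int.gcd T (D ^ M) : ℤ) ∣ T := Int.gcd_dvd_left _ _
  refine ⟨_, T₂, hT₂, Int.gcd_dvd_right _ _, ?_⟩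
  rw [Int.isCoprime_iff_gcd_eq_one]
  by_contra hne
  obtain ⟨p, hp, hpd⟩ := Nat.exists_prime_and_dvd hne
  have hp1 : (p : ℤ) ∣ T₂ := (Int.natCast_dvd_natCast.2 hpd).trans (Int.gcd_dvd_left _ _)
  have hp2 : (p : ℤ) ∣ D := (Int.natCast_dvd_natCast.2 hpd).trans (Int.gcd_dvd_right _ _)
  have hg0 : Int.gcd T (D ^ M) ≠ 0 := by
    rw [Ne, Int.gcd_eq_zero_iff]
    exact fun h0 => pow_ne_zero M hD h0.2
  obtain ⟨v, g, hpg, hg⟩ := Nat.exists_eq_pow_mul_and_not_dvd hg0 p hp.ne_one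
  have h1 : (p : ℤ) ^ (v + 1) ∣ T := by
    obtain ⟨t, ht⟩ := hp1
    exact ⟨g * t, by rw [hT₂, hg, ht]; push_cast; ring⟩
  have h2 : v + 1 ≤ M := by
    by_contra! hlt
    exact h p hp hp2 ((pow_dvd_pow _ hlt.le).trans h1)
  have h3 : (p : ℤ) ^ (v + 1) ∣ D ^ M := (pow_dvd_pow _ h2).trans (pow_dvd_pow_of_dvd hp2 M)
  have h4 : ((p ^ (v + 1) : ℕ) : ℤ) ∣ Int.gcd T (D ^ M) :=
    Int.dvd_coe_gcd (by exact_mod_cast h1) (by exact_mod_cast h3)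
  have h5 := Int.natCast_dvd_natCast.1 h4
  rw [hg, pow_succ] at h5
  exact hpg (Nat.dvd_of_mul_dvd_mul_left (pow_pos hp.pos v) h5)

end Conic

/-! ### Norm equations, globally and modulo powers of Δ -/

section Norm

set_option linter.unusedSectionVars false

variable {Δ : ℤ} [hΔ : NegDisc Δ]

theorem norm_mk (x y : ℤ) : QuadraticAlgebra.norm (⟨x, y⟩ : QuadOrder Δ) =
    x ^ 2 - parity Δ * x * y - (Δ - parity Δ ^ 2) / 4 * y ^ 2 := by
  rw [QuadraticAlgebra.norm_def]
  ring

theorem four_mul_norm (x y : ℤ) : 4 * QuadraticAlgebra.norm (⟨x, y⟩ : QuadOrder Δ) =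
    (2 * x - parity Δ * y) ^ 2 - Δ * y ^ 2 := by
  have h4 := four_mul_par (Δ := Δ)
  rw [norm_mk]
  linear_combination (-y ^ 2) * h4

theorem parity_eq_zero_of_even (h : Even Δ) : parity Δ = 0 := Int.even_iff.1 h

theorem parity_eq_one_of_odd (h : Odd Δ) : parity Δ = 1 := Int.odd_iff.1 h

theorem exists_norm_mul_of_dvd (u v : QuadOrder Δ) (c c' D : ℤ)
    (hu : D ∣ QuadraticAlgebra.norm u - c) (hv : D ∣ QuadraticAlgebra.norm v - c') :
    D ∣ QuadraticAlgebra.norm (u * v) - c * c' := by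
  obtain ⟨s, hs⟩ := hu
  obtain ⟨t, ht⟩ := hv
  rw [map_mul]
  exact ⟨s * QuadraticAlgebra.norm v + c * t, by
    linear_combination QuadraticAlgebra.norm v * hs + c * ht⟩

/-- Solution of the norm equation `N(γ) = a n²`. -/
theorem exists_norm_eq_mul_sq {a : ℤ} (ha : 0 < a) (hc : IsCoprime a Δ) {k : ℤ}
    (hk : a ∣ k ^ 2 - k * parity Δ - (Δ - parity Δ ^ 2) / 4) {δ : QuadOrder Δ}
    (hδ : Δ ∣ QuadraticAlgebra.norm δ - a) :
    ∃ (γ : QuadOrder Δ) (n : ℤ), n ≠ 0 ∧ QuadraticAlgebra.norm γ = a * n ^ 2 := by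
  have hneg := hΔ.neg
  have h4 := four_mul_par (Δ := Δ)
  obtain ⟨x, y⟩ := δ
  have hN := four_mul_norm (Δ := Δ) x y
  obtain ⟨w, hw⟩ := hδ
  generalize QuadraticAlgebra.norm (⟨x, y⟩ : QuadOrder Δ) = V at hN hw
  obtain ⟨m, hm⟩ := hk
  lift a to ℕ using ha.le
  rcases Int.even_or_odd Δ with he | ho
  -- For even Δ and d = −Δ/4 the norm form is X² + dY², with k² ≡ −d modulo a and x² ≡ a modulo d.
  · rw [parity_eq_zero_of_even he] at h4 hN hm
    obtain ⟨D, hD⟩ : ∃ D : ℤ, (Δ - 0 ^ 2) / 4 = D := ⟨_, rfl⟩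
    rw [hD] at h4 hm
    obtain ⟨d, hd⟩ := Int.eq_ofNat_of_zero_le (show 0 ≤ -D by omega)
    have hdΔ : (d : ℤ) ∣ Δ := ⟨-4, by linarith⟩
    obtain ⟨X, Y, Z, hZ, h⟩ := exists_sq_add_mul_sq_eq_mul_sq (a := a) (d := d) (r := k) (s := x)
      (by exact_mod_cast ha) (by omega)
      (Nat.isCoprime_iff_coprime.1 (IsCoprime.of_isCoprime_of_dvd_right hc hdΔ))
      ⟨m, by linarith⟩ ⟨-4 * w - y ^ 2, by
        rw [← hd]
        apply mul_left_cancel₀ (four_ne_zero (α := ℤ))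
        linear_combination 4 * hw - hN - (y ^ 2 + 4 * w) * h4⟩
    refine ⟨⟨X, Y⟩, Z, hZ, ?_⟩
    rw [norm_mk, parity_eq_zero_of_even he, hD]
    linear_combination h + Y ^ 2 * hd
  -- For odd Δ = 2h + 1 take d = −Δ. As −h inverts 2 modulo Δ and 4a ≡ (2x − y)², −h(2x − y) is a
  -- square root of a. Here √Δ = 2ω + 1, so X + Y√Δ has coordinates (X + Y, 2Y).
  · rw [parity_eq_one_of_odd ho] at h4 hN hm
    obtain ⟨d, hd⟩ := Int.eq_ofNat_of_zero_le (show 0 ≤ -Δ by omega)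
    have hdΔ : (d : ℤ) ∣ Δ := ⟨-1, by linarith⟩
    obtain ⟨h, hh⟩ := ho
    obtain ⟨X, Y, Z, hZ, hXYZ⟩ := exists_sq_add_mul_sq_eq_mul_sq (a := a) (d := d)
      (r := 2 * k - 1) (s := -h * (2 * x - y)) (by exact_mod_cast ha) (by omega)
      (Nat.isCoprime_iff_coprime.1 (IsCoprime.of_isCoprime_of_dvd_right hc hdΔ))
      ⟨4 * m, by linear_combination 4 * hm + h4 - hd⟩ (by
        have h5 : Δ ∣ (-h * (2 * x - y)) ^ 2 - a := by
          refine ⟨4 * h ^ 2 * w + h ^ 2 * y ^ 2 + (2 * h - 1) * a, ?_⟩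
          linear_combination 4 * h ^ 2 * hw - h ^ 2 * hN + (-a * (2 * h - 1)) * hh
        exact hdΔ.trans h5)
    refine ⟨⟨X + Y, 2 * Y⟩, Z, hZ, ?_⟩
    apply mul_left_cancel₀ (four_ne_zero (α := ℤ))
    rw [four_mul_norm, parity_eq_one_of_odd ⟨h, hh⟩]
    linear_combination 4 * hXYZ + 4 * Y ^ 2 * hd

/-- For odd Δ, c can be moved within its class modulo Δ^(M+1) to be 1 modulo 4Δ, hence a square
modulo Δ^M. For even Δ = 4D, c is only 1 modulo 4D; adding Dy² with y = 0 or 2 reaches 1 modulo 8D,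
where square roots lift. -/
theorem exists_norm_sub_dvd_pow_of_dvd_sub_one {c : ℤ} (hc : Δ ∣ c - 1) (M : ℕ) :
    ∃ u : QuadOrder Δ, Δ ^ M ∣ QuadraticAlgebra.norm u - c := by
  have h4 := four_mul_par (Δ := Δ)
  rcases Int.even_or_odd Δ with he | ho
  · rw [parity_eq_zero_of_even he] at h4
    obtain ⟨D, hD⟩ : ∃ D : ℤ, (Δ - 0 ^ 2) / 4 = D := ⟨_, rfl⟩
    rw [hD] at h4
    obtain ⟨w, hw⟩ := hc
    obtain ⟨y, hy⟩ : ∃ y, 4 * (2 * D) ∣ 1 - (c + D * y ^ 2) := by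
      rcases Int.even_or_odd w with ⟨t, ht⟩ | ⟨t, ht⟩
      · exact ⟨0, -t, by subst ht; linear_combination -hw + 2 * t * h4⟩
      · exact ⟨2, -t - 1, by subst ht; linear_combination -hw + (2 * t + 1) * h4⟩
    obtain ⟨r, hr⟩ := exists_sq_sub_dvd_pow hy (2 * M)
    refine ⟨⟨r, y⟩, ?_⟩
    have e : Δ ^ M ∣ (2 * D) ^ (2 * M) := by
      rw [pow_mul]
      exact pow_dvd_pow_of_dvd ⟨D, by linear_combination D * h4⟩ M
    rw [norm_mk, parity_eq_zero_of_even he, hD]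
    obtain ⟨v, hv⟩ := e.trans hr
    exact ⟨v, by linear_combination hv⟩
  · have h8 : IsCoprime (Δ ^ (M + 1)) 4 := by
      apply IsCoprime.pow_left
      obtain ⟨t, ht⟩ := ho
      have : IsCoprime Δ 2 := ⟨1, -t, by linarith⟩
      simpa using this.pow_right (n := 2)
    obtain ⟨s, t, hst⟩ := h8
    obtain ⟨w, hw⟩ := hc
    obtain ⟨c', hc'⟩ : ∃ c', c' = c + Δ ^ (M + 1) * (s * (1 - c)) := ⟨_, rfl⟩
    have h1 : 4 * Δ ∣ 1 - c' :=
      ⟨-t * w, by rw [hc']; linear_combination (-(4 * t)) * hw + (c - 1) * hst⟩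
    obtain ⟨r, hr⟩ := exists_sq_sub_dvd_pow h1 M
    obtain ⟨v, hv⟩ := (dvd_mul_left _ _).trans (mul_dvd_mul_left 1 hr)
    refine ⟨⟨r, 0⟩, v + Δ * (s * (1 - c)), ?_⟩
    rw [norm_mk]
    linear_combination hv + hc'

/-- The quotient a / N(δ), read modulo a power of Δ, is 1 modulo Δ and so a norm to high precision;
multiply by δ. -/
theorem exists_norm_sub_dvd_pow {a : ℤ} (ha : IsCoprime a Δ) {δ : QuadOrder Δ}
    (hδ : Δ ∣ QuadraticAlgebra.norm δ - a) (M : ℕ) :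
    ∃ u : QuadOrder Δ, Δ ^ M ∣ QuadraticAlgebra.norm u - a := by
  obtain ⟨w, hw⟩ := hδ
  have hN : IsCoprime (QuadraticAlgebra.norm δ) Δ := by
    rw [show QuadraticAlgebra.norm δ = a + Δ * w by linarith]
    exact ha.add_mul_left_left _
  obtain ⟨s, t, hst⟩ := hN.pow_right (n := M + 1)
  have h1 : Δ ∣ s * a - 1 := by
    have h2 : Δ ∣ QuadraticAlgebra.norm δ * (s * a - 1) :=
      ⟨-w - Δ ^ M * t * a, by linear_combination a * hst - hw⟩
    exact hN.symm.dvd_of_dvd_mul_left h2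
  obtain ⟨v, hv⟩ := exists_norm_sub_dvd_pow_of_dvd_sub_one h1 M
  refine ⟨δ * v, ?_⟩
  have h2 := exists_norm_mul_of_dvd δ v (QuadraticAlgebra.norm δ) (s * a) (Δ ^ M) (by simp) hv
  obtain ⟨x, hx⟩ := h2
  exact ⟨x - Δ * t * a, by linear_combination hx + a * hst⟩

theorem norm_smul_add_smul (γ γ₁ : QuadOrder Δ) (u v : ℤ) :
    QuadraticAlgebra.norm (⟨u, 0⟩ * γ + ⟨v, 0⟩ * γ₁) = u ^ 2 * QuadraticAlgebra.norm γ +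
      u * v * (QuadraticAlgebra.norm (γ + γ₁) - QuadraticAlgebra.norm γ -
        QuadraticAlgebra.norm γ₁) + v ^ 2 * QuadraticAlgebra.norm γ₁ := by
  simp only [QuadraticAlgebra.norm_def, QuadraticAlgebra.re_add, QuadraticAlgebra.im_add,
    QuadraticAlgebra.re_mul, QuadraticAlgebra.im_mul]
  ring

/-- The second intersection of the conic `N(γ) = a n²` with the line joining two points, with its
denominator cleared. -/
theorem exists_norm_eq_mul_sq_of_line {γ γ₁ : QuadOrder Δ} {a n e T₁ T₂ s : ℤ}
    (hγ : QuadraticAlgebra.norm γ = a * n ^ 2)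
    (hT : QuadraticAlgebra.norm (γ + ⟨n * e, 0⟩ * γ₁) = T₁ * T₂) (hT₁ : T₁ ≠ 0)
    (hs : a - e ^ 2 * QuadraticAlgebra.norm γ₁ = T₁ * s) :
    ∃ α : QuadOrder Δ, QuadraticAlgebra.norm α = a * T₂ ^ 2 := by
  -- Put P = eγ₁ and β = γ + nP. Formally, the line P + λβ meets the conic at −γ/n for λ = −1/n, and
  -- Vieta gives the other root n(a − N(P))/N(β) = ns/T₂. The witness is T₂ times that point.
  refine ⟨⟨T₂ * e, 0⟩ * γ₁ + ⟨n * s, 0⟩ * (γ + ⟨n * e, 0⟩ * γ₁), ?_⟩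
  obtain ⟨t, ht⟩ : ∃ t, t = QuadraticAlgebra.norm (γ + γ₁) - QuadraticAlgebra.norm γ -
    QuadraticAlgebra.norm γ₁ := ⟨_, rfl⟩
  have e1 := norm_smul_add_smul γ γ₁ 1 (n * e)
  have e2 := norm_smul_add_smul γ γ₁ (n * s) (T₂ * e + n * s * (n * e))
  have e3 : (⟨T₂ * e, 0⟩ * γ₁ + ⟨n * s, 0⟩ * (γ + ⟨n * e, 0⟩ * γ₁) : QuadOrder Δ) =
      ⟨n * s, 0⟩ * γ + ⟨T₂ * e + n * s * (n * e), 0⟩ * γ₁ := by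
    ext <;> simp <;> ring
  have e4 : (⟨1, 0⟩ : QuadOrder Δ) = 1 := rfl
  rw [e4, one_mul, hT, ← ht, hγ] at e1
  rw [e3, e2, ← ht, hγ]
  apply mul_left_cancel₀ (pow_ne_zero 2 hT₁)
  obtain ⟨N, hN⟩ : ∃ N, N = QuadraticAlgebra.norm γ₁ := ⟨_, rfl⟩
  rw [← hN] at e1 hs ⊢
  linear_combination (-(T₁ * s) * (T₁ * T₂ + n ^ 2 * (T₁ * s))) * e1 -
    (n ^ 2 * (T₁ * s) * (T₁ * T₂) + (T₁ * T₂) ^ 2) * hs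

/-- Weak approximation: the line through −γ/n and a Δ-adically near-solution eγ₁ meets the conic
again, and the Δ-part of the denominator cancels if N(γ + neγ₁) is not too divisible by primes of Δ.
That norm is close to 2an² + net; were it highly divisible by p for both e = 1 and e = −1, so would
be 4an². -/
theorem exists_norm_eq_mul_sq_isCoprime {a : ℤ} (hc : IsCoprime a Δ) {γ δ : QuadOrder Δ} {n : ℤ}
    (hn : n ≠ 0) (hγ : QuadraticAlgebra.norm γ = a * n ^ 2)
    (hδ : Δ ∣ QuadraticAlgebra.norm δ - a) :
    ∃ (α : QuadOrder Δ) (m : ℤ), IsCoprime m Δ ∧ QuadraticAlgebra.norm α = a * m ^ 2 := by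
  have hneg := hΔ.neg
  -- A crude exponent: p^M > M = 4n² for every prime p, so p^M cannot divide 4n².
  obtain ⟨M, hM⟩ : ∃ M : ℕ, M = (4 * n ^ 2).natAbs := ⟨_, rfl⟩
  obtain ⟨γ₁, hγ₁⟩ := exists_norm_sub_dvd_pow hc hδ (M + 1)
  obtain ⟨t, ht⟩ : ∃ t, t = QuadraticAlgebra.norm (γ + γ₁) - QuadraticAlgebra.norm γ -
    QuadraticAlgebra.norm γ₁ := ⟨_, rfl⟩
  obtain ⟨N, hN⟩ : ∃ N, N = QuadraticAlgebra.norm γ₁ := ⟨_, rfl⟩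
  rw [← hN] at hγ₁
  -- Q₁ collects the primes at which e = 1 works, Q₂ those at which e = −1 is needed.
  obtain ⟨Q₁, Q₂, hQ, hQc, hQ₁, hQ₂⟩ := exists_coprime_factorization
    (fun p => ¬ (p : ℤ) ^ M ∣ 2 * a * n ^ 2 + n * t) (Δ ^ (M + 1)).natAbs
    (by rw [Ne, Int.natAbs_eq_zero]; exact pow_ne_zero _ hneg.ne)
  have hΔQ : Δ ^ (M + 1) ∣ (Q₁ : ℤ) * Q₂ := by
    rw [← Int.natAbs_dvd, hQ]
    exact_mod_cast dvd_rfl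
  obtain ⟨i, j, hij⟩ := Nat.isCoprime_iff_coprime.2 hQc
  -- `e` is `1` modulo `Q₁` and `-1` modulo `Q₂`
  obtain ⟨e, he⟩ : ∃ e, e = j * Q₂ - i * Q₁ := ⟨_, rfl⟩
  have he₁ : (Q₁ : ℤ) ∣ e - 1 := ⟨-2 * i, by rw [he]; linear_combination hij⟩
  have he₂ : (Q₂ : ℤ) ∣ e + 1 := ⟨2 * j, by rw [he]; linear_combination -hij⟩
  have he3 : Δ ^ (M + 1) ∣ e ^ 2 - 1 := by
    rw [show e ^ 2 - 1 = (e - 1) * (e + 1) by ring]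
    exact hΔQ.trans (mul_dvd_mul he₁ he₂)
  have hprec : Δ ^ (M + 1) ∣ a - e ^ 2 * N := by
    rw [show a - e ^ 2 * N = -(N - a) - (e ^ 2 - 1) * N by ring]
    exact (hγ₁.neg_right).sub (he3.mul_right _)
  have hT := norm_smul_add_smul γ γ₁ 1 (n * e)
  have e4 : (⟨1, 0⟩ : QuadOrder Δ) = 1 := rfl
  rw [e4, one_mul, ← ht, ← hN, hγ] at hT
  have hTp : ∀ p : ℕ, p.Prime → (p : ℤ) ∣ Δ →
      ¬ (p : ℤ) ^ M ∣ QuadraticAlgebra.norm (γ + ⟨n * e, 0⟩ * γ₁) := by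
    intro p hp hpΔ hdvd
    have hpM : (p : ℤ) ^ M ∣ Δ ^ (M + 1) :=
      (pow_dvd_pow_of_dvd hpΔ M).trans (pow_dvd_pow _ M.le_succ)
    have h1 : (p : ℤ) ^ M ∣ 2 * a * n ^ 2 + n * e * t := by
      have : 2 * a * n ^ 2 + n * e * t =
          QuadraticAlgebra.norm (γ + ⟨n * e, 0⟩ * γ₁) + n ^ 2 * (a - e ^ 2 * N) := by
        rw [hT]; ring
      rw [this]
      exact hdvd.add ((hpM.trans hprec).mul_left _)
    have hpc : ∀ {Q Q' : ℕ}, Q.Coprime Q' → (p : ℤ) ^ M ∣ Q * Q' → p ∣ Q → (p : ℤ) ^ M ∣ Q := by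
      intro Q Q' hQQ hd hpQ
      refine IsCoprime.dvd_of_dvd_mul_right ?_ hd
      apply IsCoprime.pow_left
      exact Nat.isCoprime_iff_coprime.2 (hQQ.coprime_dvd_left hpQ)
    have hpQ : p ∣ Q₁ * Q₂ := by
      have : (p : ℤ) ∣ (Q₁ : ℤ) * Q₂ := (hpΔ.trans (dvd_pow_self _ M.succ_ne_zero)).trans hΔQ
      exact_mod_cast this
    rcases hp.dvd_mul.1 hpQ with h | h
    · apply hQ₁ p hp h
      rw [show 2 * a * n ^ 2 + n * t = 2 * a * n ^ 2 + n * e * t - (e - 1) * (n * t) by ring]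
      exact h1.sub (((hpc hQc (hpM.trans hΔQ) h).trans he₁).mul_right _)
    · have h2 := hQ₂ p hp h
      rw [not_not] at h2
      have h3 : (p : ℤ) ^ M ∣ 2 * a * n ^ 2 - n * t := by
        rw [show 2 * a * n ^ 2 - n * t = 2 * a * n ^ 2 + n * e * t - (e + 1) * (n * t) by ring]
        exact h1.sub (((hpc hQc.symm (by rw [mul_comm]; exact hpM.trans hΔQ) h).trans
          he₂).mul_right _)
      have h4 : (p : ℤ) ^ M ∣ a * (4 * n ^ 2) := by
        rw [show a * (4 * n ^ 2) = 2 * a * n ^ 2 + n * t + (2 * a * n ^ 2 - n * t) by ring]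
        exact h2.add h3
      have hpa : IsCoprime ((p : ℤ) ^ M) a :=
        (IsCoprime.of_isCoprime_of_dvd_left hc.symm hpΔ).pow_left
      have h5 := hpa.dvd_of_dvd_mul_left h4
      have h6 := Nat.le_of_dvd (by positivity) (Int.natAbs_dvd_natAbs.2 h5)
      rw [← hM, Int.natAbs_pow, Int.natAbs_natCast] at h6
      exact absurd (Nat.lt_pow_self hp.one_lt) (not_lt.2 h6)
  obtain ⟨T₁, T₂, hT12, hT₁, hT₂⟩ := exists_mul_dvd_pow_isCoprime hneg.ne hTp
  obtain ⟨s, hs⟩ := (hT₁.trans (pow_dvd_pow _ M.le_succ)).trans hprec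
  have hT0 : T₁ ≠ 0 := by
    rintro rfl
    exact pow_ne_zero _ hneg.ne (zero_dvd_iff.1 hT₁)
  rw [hN] at hs
  obtain ⟨α, hα⟩ := exists_norm_eq_mul_sq_of_line hγ hT12 hT0 hs
  exact ⟨α, T₂, hT₂, hα⟩

end Norm

/-! ### Good representatives of classes; value sets as cosets -/

section Representatives

set_option linter.unusedSectionVars false

variable {Δ : ℤ} [hΔ : NegDisc Δ]

theorem BinForm.isPrimitive_of_isCoprime {q : BinForm ℤ} (h : IsCoprime q.a q.disc) :
    q.IsPrimitive := by
  obtain ⟨s, t, hst⟩ := h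
  rw [BinForm.IsPrimitive, Ideal.eq_top_iff_one, Submodule.mem_span_triple]
  refine ⟨s - 4 * t * q.c, t * q.b, 0, ?_⟩
  simp only [BinForm.disc] at hst
  simp only [smul_eq_mul]
  linear_combination hst

/-- A prime dividing q(1, 0), q(0, 1) and q(1, 1) divides every coefficient; coprime moduli are
glued by the Chinese remainder theorem. -/
theorem BinForm.exists_eval_isCoprime {q : BinForm ℤ} (hq : q.IsPrimitive) (n : ℕ) (hn : n ≠ 0) :
    ∃ x y : ℤ, IsCoprime (q.eval x y) n := by
  induction n using Nat.recOnPosPrimePosCoprime with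
  | prime_pow p k hp hk =>
    have hpr := Nat.prime_iff_prime_int.1 hp
    have hcop : ∀ z : ℤ, ¬ (p : ℤ) ∣ z → IsCoprime z ((p ^ k : ℕ) : ℤ) := by
      intro z hz
      rw [Nat.cast_pow]
      exact ((hpr.coprime_iff_not_dvd).2 hz).symm.pow_right
    by_contra! h
    have h1 : ∀ x y : ℤ, (p : ℤ) ∣ q.eval x y := fun x y => by
      by_contra hd
      exact h x y (hcop _ hd)
    have ha : (p : ℤ) ∣ q.a := by simpa [BinForm.eval] using h1 1 0
    have hc : (p : ℤ) ∣ q.c := by simpa [BinForm.eval] using h1 0 1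
    have hb : (p : ℤ) ∣ q.b := by
      have h2 : (p : ℤ) ∣ q.a + q.b + q.c := by simpa [BinForm.eval] using h1 1 1
      rw [show q.b = q.a + q.b + q.c - q.a - q.c by ring]
      exact (h2.sub ha).sub hc
    have hle : Ideal.span {q.a, q.b, q.c} ≤ Ideal.span {(p : ℤ)} := by
      rw [Ideal.span_le]
      rintro z (rfl | rfl | rfl) <;> exact Ideal.mem_span_singleton.2 ‹_›
    rw [show Ideal.span {q.a, q.b, q.c} = ⊤ from hq, top_le_iff, Ideal.span_singleton_eq_top] at hle
    exact hpr.not_isUnit hle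
  | zero => exact absurd rfl hn
  | one => exact ⟨0, 0, by simpa using isCoprime_one_right⟩
  | coprime m n hm hn' hmn ihm ihn =>
    obtain ⟨x, y, h⟩ := ihm (by omega)
    obtain ⟨x', y', h'⟩ := ihn (by omega)
    obtain ⟨s, t, hst⟩ := Nat.isCoprime_iff_coprime.2 hmn
    refine ⟨x + m * (s * (x' - x)), y + m * (s * (y' - y)), ?_⟩
    rw [Nat.cast_mul]
    apply IsCoprime.mul_right
    · have e : q.eval (x + m * (s * (x' - x))) (y + m * (s * (y' - y))) = q.eval x y +
          m * (q.a * (s * (x' - x)) * (2 * x + m * (s * (x' - x))) +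
            q.b * (x * (s * (y' - y)) + s * (x' - x) * y + m * (s * (x' - x)) * (s * (y' - y))) +
            q.c * (s * (y' - y)) * (2 * y + m * (s * (y' - y)))) := by
        simp only [BinForm.eval]; ring
      rw [e]
      exact h.add_mul_left_left _
    · have ex : x + m * (s * (x' - x)) = x' + n * (t * (x - x')) := by
        linear_combination (x' - x) * hst
      have ey : y + m * (s * (y' - y)) = y' + n * (t * (y - y')) := by
        linear_combination (y' - y) * hst
      rw [ex, ey]
      have e : q.eval (x' + n * (t * (x - x'))) (y' + n * (t * (y - y'))) = q.eval x' y' +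
          n * (q.a * (t * (x - x')) * (2 * x' + n * (t * (x - x'))) +
            q.b * (x' * (t * (y - y')) + t * (x - x') * y' + n * (t * (x - x')) * (t * (y - y'))) +
            q.c * (t * (y - y')) * (2 * y' + n * (t * (y - y')))) := by
        simp only [BinForm.eval]; ring
      rw [e]
      exact h'.add_mul_left_left _

theorem BinForm.eval_mul_mul (q : BinForm ℤ) (x y g : ℤ) :
    q.eval (x * g) (y * g) = q.eval x y * g ^ 2 := by
  simp only [BinForm.eval]; ring

theorem BinForm.exists_isCoprime_eval_isCoprime {q : BinForm ℤ} (hq : q.IsPrimitive) {N : ℤ}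
    (hN : N ≠ 0) : ∃ x y : ℤ, IsCoprime x y ∧ IsCoprime (q.eval x y) N := by
  -- The factor 2 keeps the modulus a nonunit even for N = ±1, which excludes x = y = 0.
  obtain ⟨x, y, h⟩ := BinForm.exists_eval_isCoprime hq (2 * N).natAbs (by omega)
  have h2 : IsCoprime (q.eval x y) (2 * N) :=
    IsCoprime.of_isCoprime_of_dvd_right h (Int.dvd_natAbs.2 dvd_rfl)
  have hg0 : 0 < Int.gcd x y := by
    rw [Int.gcd_pos_iff]
    by_contra! h0
    rw [h0.1, h0.2] at h2
    have h3 : IsUnit (2 * N) := by simpa [BinForm.eval, isCoprime_zero_left] using h2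
    rcases Int.isUnit_iff.1 h3 with h | h <;> omega
  obtain ⟨x', y', hxy, hx, hy⟩ := Int.exists_gcd_one hg0
  refine ⟨x', y', Int.isCoprime_iff_gcd_eq_one.2 hxy, ?_⟩
  have e : q.eval x y = q.eval x' y' * (Int.gcd x y : ℤ) ^ 2 := by
    rw [← BinForm.eval_mul_mul, ← hx, ← hy]
  rw [e] at h2
  exact (h2.of_mul_left_left).of_mul_right_right

theorem ClTw.mk_eq_mk_of_twist {q q' : PrimForm ℤ Δ} (M : GL (Fin 2) ℤ)
    (h : q'.1 = q.1.twist M) : ClTw.mk q' = ClTw.mk q :=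
  (Quotient.sound (s := twSetoid ℤ Δ) (⟨M, h⟩ : ∃ M : GL (Fin 2) ℤ, q'.1 = q.1.twist M)).symm

theorem exists_mk_eq_of_isCoprime (q : PrimForm ℤ Δ) {x y : ℤ} (hxy : IsCoprime x y)
    (h : IsCoprime (q.1.eval x y) Δ) :
    ∃ q' : PrimForm ℤ Δ, ClTw.mk q' = ClTw.mk q ∧ q'.1.a = q.1.eval x y := by
  obtain ⟨s, t, hst⟩ := hxy
  have hdet : Matrix.det !![x, -t; y, s] = 1 := by
    rw [Matrix.det_fin_two_of]; linear_combination hst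
  obtain ⟨M, hM⟩ : ∃ M, M = Matrix.GeneralLinearGroup.mk'' !![x, -t; y, s]
    (hdet ▸ isUnit_one) := ⟨_, rfl⟩
  obtain ⟨d, -, hd, hd2⟩ := sq_det_inv M
  have h00 : M 0 0 = x := by rw [hM]; rfl
  have h01 : M 0 1 = -t := by rw [hM]; rfl
  have h10 : M 1 0 = y := by rw [hM]; rfl
  have h11 : M 1 1 = s := by rw [hM]; rfl
  have hd1 : d = 1 := by rw [← hd, h00, h01, h10, h11]; linear_combination hst
  have ha : (q.1.twist M).a = q.1.eval x y := by
    simp only [BinForm.twist, hd2, hd1, h00, h10, one_mul]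
  have hdisc : (q.1.twist M).disc = Δ := by
    have hq : q.1.b ^ 2 - 4 * q.1.a * q.1.c = Δ := q.2.2
    simp only [BinForm.disc, BinForm.twist, hd2, hd1, h00, h01, h10, h11, one_mul, BinForm.eval]
    linear_combination (x * s + t * y) ^ 2 * hq + Δ * (x * s + y * t + 1) * hst
  refine ⟨⟨q.1.twist M, BinForm.isPrimitive_of_isCoprime (by rw [ha, hdisc]; exact h), hdisc⟩,
    ClTw.mk_eq_mk_of_twist M rfl, ha⟩

/-- The twist by diag(1, −1). It is the source of the sign in ± Val(q₀) and allows positive leading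
coefficients. -/
theorem exists_mk_eq_neg (q : PrimForm ℤ Δ) (h : IsCoprime q.1.a Δ) :
    ∃ q' : PrimForm ℤ Δ, ClTw.mk q' = ClTw.mk q ∧ q'.1 = ⟨-q.1.a, q.1.b, -q.1.c⟩ := by
  have hdet : Matrix.det !![(1 : ℤ), 0; 0, -1] = -1 := by simp
  obtain ⟨M, hM⟩ : ∃ M, M = Matrix.GeneralLinearGroup.mk'' !![(1 : ℤ), 0; 0, -1]
    (hdet ▸ isUnit_one.neg) := ⟨_, rfl⟩
  obtain ⟨d, -, hd, hd2⟩ := sq_det_inv M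
  have h00 : M 0 0 = 1 := by rw [hM]; rfl
  have h01 : M 0 1 = 0 := by rw [hM]; rfl
  have h10 : M 1 0 = 0 := by rw [hM]; rfl
  have h11 : M 1 1 = -1 := by rw [hM]; rfl
  have hd1 : d = -1 := by rw [← hd, h00, h01, h10, h11]; rfl
  have hdisc : (⟨-q.1.a, q.1.b, -q.1.c⟩ : BinForm ℤ).disc = Δ := by
    have hq : q.1.b ^ 2 - 4 * q.1.a * q.1.c = Δ := q.2.2
    simp only [BinForm.disc]
    linear_combination hq
  refine ⟨⟨⟨-q.1.a, q.1.b, -q.1.c⟩, BinForm.isPrimitive_of_isCoprime ?_, hdisc⟩,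
    ClTw.mk_eq_mk_of_twist M ?_, rfl⟩
  · rw [hdisc]; exact h.neg_left
  · ext <;> simp only [BinForm.twist, hd2, hd1, h00, h01, h10, h11, BinForm.eval] <;> ring

theorem exists_mk_eq_pos (C : ClTw ℤ Δ) {N : ℤ} (hN : N ≠ 0) :
    ∃ q : PrimForm ℤ Δ, ClTw.mk q = C ∧ 0 < q.1.a ∧ IsCoprime q.1.a Δ ∧ IsCoprime q.1.a N := by
  have hneg := hΔ.neg
  obtain ⟨q, rfl⟩ : ∃ q, ClTw.mk q = C := Quotient.exists_rep C
  obtain ⟨x, y, hxy, h⟩ :=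
    BinForm.exists_isCoprime_eval_isCoprime q.2.1 (mul_ne_zero hneg.ne hN)
  have hcΔ := h.of_mul_right_left
  have hcN := h.of_mul_right_right
  obtain ⟨q', hq', ha⟩ := exists_mk_eq_of_isCoprime q hxy hcΔ
  rw [← ha] at hcΔ hcN
  rcases lt_or_gt_of_ne q'.a_ne_zero with h0 | h0
  · obtain ⟨q'', hq'', he⟩ := exists_mk_eq_neg q' hcΔ
    refine ⟨q'', hq''.trans hq', ?_, ?_, ?_⟩ <;> rw [he]
    · simpa using h0
    · exact hcΔ.neg_left
    · exact hcN.neg_left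
  · exact ⟨q', hq', h0, hcΔ, hcN⟩

/-- Up to the factor a, q is the norm form restricted to the ideal of q. -/
theorem mul_eval_eq_eval_principalForm (q : PrimForm ℤ Δ) {k : ℤ}
    (hk : q.1.b = parity Δ - 2 * k) (x y : ℤ) :
    q.1.a * q.1.eval x y = (principalForm Δ).eval (q.1.a * x - k * y) y := by
  have hac := q.mul_coeff hk
  simp only [BinForm.eval, principalForm]
  linear_combination q.1.a * x * y * hk + y ^ 2 * hac

theorem norm_eq_eval_principalForm (x y : ℤ) :
    QuadraticAlgebra.norm (⟨x, y⟩ : QuadOrder Δ) = (principalForm Δ).eval x (-y) := by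
  rw [norm_mk]
  simp only [BinForm.eval, principalForm]
  ring

theorem mem_val_iff_mul_mem_valSubgroup (q : PrimForm ℤ Δ) {u v : (ZMod Δ.natAbs)ˣ}
    (hu : (u : ZMod Δ.natAbs) = q.1.a) : v ∈ val Δ q.1 ↔ u * v ∈ valSubgroup Δ := by
  obtain ⟨k, hk⟩ : ∃ k, q.1.b = parity Δ - 2 * k := ⟨_, q.exists_shift⟩
  have hmem : ∀ w : (ZMod Δ.natAbs)ˣ, w ∈ valSubgroup Δ ↔ w ∈ val Δ (principalForm Δ) :=
    fun w => Iff.rfl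
  rw [hmem, mem_val_iff, mem_val_iff]
  constructor
  · rintro ⟨x, y, h⟩
    refine ⟨q.1.a * x - k * y, y, ?_⟩
    rw [← mul_eval_eq_eval_principalForm q hk, Int.cast_mul, h, ← hu, Units.val_mul]
  · rintro ⟨x, y, h⟩
    -- Since s inverts a modulo Δ, the substitution x ↦ ax − ky can be undone there.
    obtain ⟨s, t, hst⟩ := isCoprime_of_cast_eq_unit hu.symm
    refine ⟨s * (x + k * y), y, ?_⟩
    rw [Units.val_mul] at h
    apply u.isUnit.mul_left_cancel
    rw [← h, hu, ← Int.cast_mul, mul_eval_eq_eval_principalForm q hk, intCast_natAbs_dvd]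
    have e : q.1.a * (s * (x + k * y)) - k * y = x + Δ * (-t * (x + k * y)) := by
      linear_combination (x + k * y) * hst
    rw [e]
    refine ⟨-t * (x + k * y) * (2 * x + Δ * (-t * (x + k * y)) + parity Δ * y), ?_⟩
    simp only [BinForm.eval, principalForm]
    ring

theorem sq_mem_valSubgroup (u : (ZMod Δ.natAbs)ˣ) : u * u ∈ valSubgroup Δ :=
  ⟨u, 0, by simp [principalForm, BinForm.map, BinForm.eval, sq]⟩

/-- Unit squares lie in Val(q₀), so the quotient has exponent 2 and inverses may be dropped. -/
theorem mk_eq_mk_iff_mul_mem (u v : (ZMod Δ.natAbs)ˣ) :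
    (v : (ZMod Δ.natAbs)ˣ ⧸ pmValSubgroup Δ) = u ↔ u * v ∈ pmValSubgroup Δ := by
  rw [QuotientGroup.eq]
  have h : v * v ∈ pmValSubgroup Δ := Or.inl (sq_mem_valSubgroup v)
  rw [show u * v = v⁻¹ * u * (v * v) by
    rw [mul_comm v⁻¹ u, mul_assoc, ← mul_assoc v⁻¹, inv_mul_cancel, one_mul]]
  exact (Subgroup.mul_mem_cancel_right _ h).symm

theorem mem_val_of_mem_val_twist {q : BinForm ℤ} (M : GL (Fin 2) ℤ) {v : (ZMod Δ.natAbs)ˣ}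
    (h : v ∈ val Δ (q.twist M)) : v ∈ val Δ q ∨ -v ∈ val Δ q := by
  obtain ⟨x, y, hxy⟩ := mem_val_iff.1 h
  rw [BinForm.eval_twist] at hxy
  rcases Int.units_eq_one_or (Matrix.GeneralLinearGroup.det M)⁻¹ with hd | hd
  · left
    rw [mem_val_iff]
    exact ⟨_, _, by rw [← hxy, hd, Units.val_one, one_mul]⟩
  · right
    rw [mem_val_iff]
    refine ⟨M 0 0 * x + M 0 1 * y, M 1 0 * x + M 1 1 * y, ?_⟩
    rw [Units.val_neg, ← hxy, hd]
    simp

theorem mem_classVal_iff (q : PrimForm ℤ Δ) {u v : (ZMod Δ.natAbs)ˣ}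
    (hu : (u : ZMod Δ.natAbs) = q.1.a) : v ∈ classVal (ClTw.mk q) ↔
      (v : (ZMod Δ.natAbs)ˣ ⧸ pmValSubgroup Δ) = u := by
  rw [mk_eq_mk_iff_mul_mem]
  constructor
  · rintro ⟨q', hq', hv⟩
    obtain ⟨M, hM⟩ : (twSetoid ℤ Δ) q q' := Quotient.exact hq'.symm
    rw [hM] at hv
    rcases mem_val_of_mem_val_twist M hv with h | h
    · exact Or.inl ((mem_val_iff_mul_mem_valSubgroup q hu).1 h)
    · refine Or.inr ?_
      rw [← mul_neg]
      exact (mem_val_iff_mul_mem_valSubgroup q hu).1 h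
  · rintro (h | h)
    · exact ⟨q, rfl, (mem_val_iff_mul_mem_valSubgroup q hu).2 h⟩
    · obtain ⟨q', hq', he⟩ := exists_mk_eq_neg q (isCoprime_of_cast_eq_unit hu.symm)
      refine ⟨q', hq', (mem_val_iff_mul_mem_valSubgroup (u := -u) q' ?_).2 ?_⟩
      · rw [he, Units.val_neg, hu]; simp
      · rwa [neg_mul]

end Representatives

/-! ### Dirichlet composition, squares, and the principal genus -/

section Composition

set_option linter.unusedSectionVars false

variable {Δ : ℤ} [hΔ : NegDisc Δ]

open nonZeroDivisors

/-- Concordant forms: (ω + k)² = (2k − π)(ω + k) − a₃c₃, so `hrst` produces ω + k inside the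
product. The middle-coefficient term in `hrst` admits leading coefficients that are not coprime, as
squaring requires. -/
theorem formIdeal_mul_formIdeal {q₁ q₂ q₃ : PrimForm ℤ Δ} {k r s t : ℤ}
    (h₁ : q₁.1.b = parity Δ - 2 * k) (h₂ : q₂.1.b = parity Δ - 2 * k)
    (h₃ : q₃.1.b = parity Δ - 2 * k) (ha : q₃.1.a = q₁.1.a * q₂.1.a)
    (hrst : r * q₁.1.a + s * q₂.1.a + t * (2 * k - parity Δ) = 1) :
    formIdeal q₁ * formIdeal q₂ = formIdeal q₃ := by
  have hac := q₃.mul_coeff h₃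
  rw [formIdeal_eq q₁ h₁, formIdeal_eq q₂ h₂, formIdeal_eq q₃ h₃, Ideal.span_pair_mul_span_pair]
  have eA : (⟨q₃.1.a, 0⟩ : QuadOrder Δ) = ⟨q₁.1.a, 0⟩ * ⟨q₂.1.a, 0⟩ := by
    ext
    · simp [ha]
    · simp
  apply le_antisymm
  · have hk : (⟨k, 1⟩ : QuadOrder Δ) ∈ Ideal.span {(⟨k, 1⟩ : QuadOrder Δ), ⟨q₃.1.a, 0⟩} :=
      Ideal.subset_span (Or.inl rfl)
    rw [Ideal.span_le]
    rintro z (rfl | rfl | rfl | rfl)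
    · exact Ideal.mul_mem_left _ _ hk
    · exact Ideal.mul_mem_right _ _ hk
    · exact Ideal.mul_mem_left _ _ hk
    · exact Ideal.subset_span (Or.inr eA.symm)
  · have m1 := Ideal.subset_span (s := {(⟨k, 1⟩ * ⟨k, 1⟩ : QuadOrder Δ),
      ⟨k, 1⟩ * ⟨q₂.1.a, 0⟩, ⟨q₁.1.a, 0⟩ * ⟨k, 1⟩, ⟨q₁.1.a, 0⟩ * ⟨q₂.1.a, 0⟩})
    have n1 := m1 (Or.inl rfl)
    have n2 := m1 (Or.inr (Or.inl rfl))
    have n3 := m1 (Or.inr (Or.inr (Or.inl rfl)))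
    have n4 := m1 (Or.inr (Or.inr (Or.inr rfl)))
    rw [Ideal.span_le]
    rintro z (rfl | rfl)
    · have e : (⟨k, 1⟩ : QuadOrder Δ) = ⟨t, 0⟩ * (⟨k, 1⟩ * ⟨k, 1⟩) +
          (⟨s, 0⟩ * (⟨k, 1⟩ * ⟨q₂.1.a, 0⟩) + (⟨r, 0⟩ * (⟨q₁.1.a, 0⟩ * ⟨k, 1⟩) +
          ⟨t * q₃.1.c, 0⟩ * (⟨q₁.1.a, 0⟩ * ⟨q₂.1.a, 0⟩))) := by
        rw [← eA]
        ext
        · simp only [QuadraticAlgebra.re_add, QuadraticAlgebra.re_mul, QuadraticAlgebra.im_mul]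
          linear_combination (-k) * hrst - t * hac
        · simp only [QuadraticAlgebra.im_add, QuadraticAlgebra.re_mul, QuadraticAlgebra.im_mul]
          linear_combination -hrst
      have hmem := add_mem (Ideal.mul_mem_left _ ⟨t, 0⟩ n1)
        (add_mem (Ideal.mul_mem_left _ ⟨s, 0⟩ n2) (add_mem (Ideal.mul_mem_left _ ⟨r, 0⟩ n3)
          (Ideal.mul_mem_left _ ⟨t * q₃.1.c, 0⟩ n4)))
      rwa [← e] at hmem
    · rw [← eA] at n4
      rwa [← eA]

theorem ClTw.equivClassGroup_mk (q : PrimForm ℤ Δ) :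
    ClTw.equivClassGroup (ClTw.mk q) = formClass q := rfl

theorem ClTw.equivClassGroup_mul (C D : ClTw ℤ Δ) : ClTw.equivClassGroup (C * D) =
    ClTw.equivClassGroup C * ClTw.equivClassGroup D :=
  ClTw.equivClassGroup.apply_symm_apply _

theorem mk_eq_mk_of_formIdeal_eq {q q' : PrimForm ℤ Δ} (h : formIdeal q = formIdeal q') :
    ClTw.mk q = ClTw.mk q' := by
  apply ClTw.equivClassGroup.injective
  rw [ClTw.equivClassGroup_mk, ClTw.equivClassGroup_mk, formClass_eq_iff]
  exact ⟨1, 1, one_ne_zero, one_ne_zero, by rw [h]⟩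

theorem mk_mul_mk_of_formIdeal_mul {q₁ q₂ q₃ : PrimForm ℤ Δ}
    (h : formIdeal q₁ * formIdeal q₂ = formIdeal q₃) :
    ClTw.mk q₁ * ClTw.mk q₂ = ClTw.mk q₃ := by
  apply ClTw.equivClassGroup.injective
  rw [ClTw.equivClassGroup_mul, ClTw.equivClassGroup_mk, ClTw.equivClassGroup_mk,
    ClTw.equivClassGroup_mk, formClass, formClass, formClass, ← map_mul]
  congr 1
  apply Units.ext
  rw [Units.val_mul, IsUnit.unit_spec, IsUnit.unit_spec, IsUnit.unit_spec,
    ← FractionalIdeal.coeIdeal_mul, h]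

theorem exists_primForm {a c k : ℤ} (hc : IsCoprime a Δ)
    (h : a * c = k ^ 2 - k * parity Δ - (Δ - parity Δ ^ 2) / 4) :
    ∃ q : PrimForm ℤ Δ, q.1 = ⟨a, parity Δ - 2 * k, c⟩ := by
  have hdisc : (⟨a, parity Δ - 2 * k, c⟩ : BinForm ℤ).disc = Δ := by
    have h4 := four_mul_par (Δ := Δ)
    simp only [BinForm.disc]
    linear_combination h4 - 4 * h
  exact ⟨⟨_, BinForm.isPrimitive_of_isCoprime (by rw [hdisc]; exact hc), hdisc⟩, rfl⟩

/-- The ideal depends on k only modulo a. -/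
theorem exists_primForm_of_modEq (q : PrimForm ℤ Δ) {k k' : ℤ} (hk : q.1.b = parity Δ - 2 * k)
    (hc : IsCoprime q.1.a Δ) (h : q.1.a ∣ k' - k) :
    ∃ q' : PrimForm ℤ Δ, ClTw.mk q' = ClTw.mk q ∧ q'.1.a = q.1.a ∧
      q'.1.b = parity Δ - 2 * k' := by
  obtain ⟨w, hw⟩ := h
  obtain ⟨q', hq'⟩ := exists_primForm (a := q.1.a) (k := k')
    (c := q.1.c + w * (k' + k - parity Δ)) hc
    (by linear_combination q.mul_coeff hk - (k' + k - parity Δ) * hw)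
  have ha : q'.1.a = q.1.a := by rw [hq']
  have hb : q'.1.b = parity Δ - 2 * k' := by rw [hq']
  refine ⟨q', mk_eq_mk_of_formIdeal_eq ?_, ha, hb⟩
  ext z
  rw [mem_formIdeal q hk, mem_formIdeal q' hb, ha,
    show z.re - k' * z.im = z.re - k * z.im - q.1.a * (w * z.im) by
      linear_combination (-z.im) * hw]
  exact (dvd_sub_left (Dvd.intro _ rfl))

theorem exists_mk_mul_mk (C₁ C₂ : ClTw ℤ Δ) : ∃ q₁ q₂ q₃ : PrimForm ℤ Δ, ClTw.mk q₁ = C₁ ∧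
    ClTw.mk q₂ = C₂ ∧ ClTw.mk q₃ = C₁ * C₂ ∧ q₃.1.a = q₁.1.a * q₂.1.a ∧
    IsCoprime q₁.1.a Δ ∧ IsCoprime q₂.1.a Δ := by
  obtain ⟨q₁, rfl, -, h₁, -⟩ := exists_mk_eq_pos C₁ one_ne_zero
  obtain ⟨q₂, rfl, -, h₂, h₁₂⟩ := exists_mk_eq_pos C₂ q₁.a_ne_zero
  obtain ⟨k₁, hk₁⟩ : ∃ k, q₁.1.b = parity Δ - 2 * k := ⟨_, q₁.exists_shift⟩
  obtain ⟨k₂, hk₂⟩ : ∃ k, q₂.1.b = parity Δ - 2 * k := ⟨_, q₂.exists_shift⟩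
  obtain ⟨s, t, hst⟩ := h₁₂
  -- The common k is k₁ modulo a₁ and k₂ modulo a₂, by the Chinese remainder theorem.
  obtain ⟨q₁', e₁, ha₁, hb₁⟩ := exists_primForm_of_modEq q₁
    (k' := k₁ + t * q₁.1.a * (k₂ - k₁)) hk₁ h₁ ⟨t * (k₂ - k₁), by ring⟩
  obtain ⟨q₂', e₂, ha₂, hb₂⟩ := exists_primForm_of_modEq q₂
    (k' := k₁ + t * q₁.1.a * (k₂ - k₁)) hk₂ h₂ ⟨s * (k₁ - k₂), by
      linear_combination (k₂ - k₁) * hst⟩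
  have hd : q₁.1.a * q₂.1.a ∣ (k₁ + t * q₁.1.a * (k₂ - k₁)) ^ 2 -
      (k₁ + t * q₁.1.a * (k₂ - k₁)) * parity Δ - (Δ - parity Δ ^ 2) / 4 := by
    apply IsCoprime.mul_dvd ⟨t, s, by linarith⟩
    · exact ⟨q₁'.1.c, by rw [← q₁'.mul_coeff hb₁, ha₁]⟩
    · exact ⟨q₂'.1.c, by rw [← q₂'.mul_coeff hb₂, ha₂]⟩
  obtain ⟨c, hc⟩ := hd
  obtain ⟨q₃, h₃⟩ := exists_primForm (h₁.mul_left h₂) hc.symm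
  refine ⟨q₁', q₂', q₃, e₁, e₂, ?_, by rw [h₃, ha₁, ha₂], by rwa [ha₁], by rwa [ha₂]⟩
  rw [← e₁, ← e₂]
  refine (mk_mul_mk_of_formIdeal_mul (formIdeal_mul_formIdeal (r := t) (s := s) (t := 0) hb₁ hb₂
    (by rw [h₃]) (by rw [h₃, ha₁, ha₂]) ?_)).symm
  rw [ha₁, ha₂]
  linarith

/-- The root is [m, b, mc]. It is concordant with itself because b² ≡ Δ modulo m makes m prime to b.
-/
theorem isSquare_mk_of_eq_sq (q : PrimForm ℤ Δ) {m : ℤ} (hm : IsCoprime m Δ)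
    (h : q.1.a = m ^ 2) : IsSquare (ClTw.mk q) := by
  obtain ⟨k, hk⟩ : ∃ k, q.1.b = parity Δ - 2 * k := ⟨_, q.exists_shift⟩
  have hac := q.mul_coeff hk
  have h4 := four_mul_par (Δ := Δ)
  obtain ⟨q', hq'⟩ := exists_primForm (a := m) (c := m * q.1.c) (k := k) hm
    (by rw [← hac, h]; ring)
  have hcop : IsCoprime m (2 * k - parity Δ) := by
    have h1 : IsCoprime m ((2 * k - parity Δ) ^ 2) := by
      rw [show (2 * k - parity Δ) ^ 2 = Δ + m * (4 * m * q.1.c) by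
        rw [h] at hac; linear_combination h4 - 4 * hac]
      exact (hm.symm.add_mul_left_left _).symm
    exact (IsCoprime.pow_right_iff two_pos).1 h1
  obtain ⟨r, t, hrt⟩ := hcop
  refine ⟨ClTw.mk q', (mk_mul_mk_of_formIdeal_mul (formIdeal_mul_formIdeal (r := r) (s := 0)
    (t := t) (k := k) ?_ ?_ hk ?_ ?_)).symm⟩
  · rw [hq']
  · rw [hq']
  · rw [hq', h]; ring
  · rw [hq']; linarith

theorem exists_eval_eq_sq (q : PrimForm ℤ Δ) (ha : 0 < q.1.a) (hc : IsCoprime q.1.a Δ)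
    {δ : QuadOrder Δ} (hδ : Δ ∣ QuadraticAlgebra.norm δ - q.1.a) :
    ∃ x y m : ℤ, IsCoprime x y ∧ IsCoprime m Δ ∧ q.1.eval x y = m ^ 2 := by
  obtain ⟨k, hk⟩ : ∃ k, q.1.b = parity Δ - 2 * k := ⟨_, q.exists_shift⟩
  obtain ⟨γ, n, hn, hγ⟩ := exists_norm_eq_mul_sq ha hc ⟨_, (q.mul_coeff hk).symm⟩ hδ
  obtain ⟨⟨A, B⟩, m, hm, hα⟩ := exists_norm_eq_mul_sq_isCoprime hc hn hγ hδ
  -- These coordinates describe aα, which lies in the ideal of q: ax − ky = aA, and q takes the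
  -- value N(aα)/a = (am)².
  obtain ⟨x, hx⟩ : ∃ x, x = A - k * B := ⟨_, rfl⟩
  obtain ⟨y, hy⟩ : ∃ y, y = -(q.1.a * B) := ⟨_, rfl⟩
  have hxy : q.1.eval x y = (q.1.a * m) ^ 2 := by
    apply mul_left_cancel₀ q.a_ne_zero
    rw [mul_eval_eq_eval_principalForm q hk, hx, hy,
      show q.1.a * (A - k * B) - k * -(q.1.a * B) = A * q.1.a by ring,
      show -(q.1.a * B) = -B * q.1.a by ring, BinForm.eval_mul_mul,
      ← norm_eq_eval_principalForm, hα]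
    ring
  have ham : IsCoprime (q.1.a * m) Δ := hc.mul_left hm
  have hneg := hΔ.neg
  have hg0 : 0 < Int.gcd x y := by
    rw [Int.gcd_pos_iff]
    by_contra! h0
    rw [h0.1, h0.2] at hxy
    have h1 : q.1.a * m = 0 := by
      apply pow_eq_zero_iff two_ne_zero |>.1
      rw [← hxy]; simp [BinForm.eval]
    rw [h1, isCoprime_zero_left] at ham
    have h2 : Δ = -1 := by rcases Int.isUnit_iff.1 ham with h | h <;> omega
    rcases hΔ.mod_four with h | h <;> rw [h2] at h <;> exact absurd h (by decide)
  obtain ⟨x', y', hxy', hx', hy'⟩ := Int.exists_gcd_one hg0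
  have e : q.1.eval x y = q.1.eval x' y' * (Int.gcd x y : ℤ) ^ 2 := by
    rw [← BinForm.eval_mul_mul, ← hx', ← hy']
  rw [hxy] at e
  obtain ⟨m', hm'⟩ := (Int.pow_dvd_pow_iff two_ne_zero).1 (Dvd.intro_left _ e.symm)
  refine ⟨x', y', m', Int.isCoprime_iff_gcd_eq_one.2 hxy',
    IsCoprime.of_isCoprime_of_dvd_left ham ⟨_, hm'.trans (mul_comm _ _)⟩, ?_⟩
  apply mul_right_cancel₀ (pow_ne_zero 2 (Int.natCast_ne_zero.2 hg0.ne'))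
  rw [← e, hm']
  ring

/-- A class whose genus is trivial is a square. -/
theorem isSquare_of_one_mem_classVal {C : ClTw ℤ Δ} (h : 1 ∈ classVal C) : IsSquare C := by
  -- For positive odd a, χ(a) is the Jacobi symbol (Δ / a), which is 1 because b² ≡ Δ modulo a. This
  -- rules out −a in Val(q₀).
  obtain ⟨q, rfl, ha, hc, h2⟩ := exists_mk_eq_pos C two_ne_zero
  obtain ⟨k, hk⟩ : ∃ k, q.1.b = parity Δ - 2 * k := ⟨_, q.exists_shift⟩
  obtain ⟨u, hu⟩ := exists_unit_of_isCoprime hc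
  have hmem : u ∈ pmValSubgroup Δ := by
    have := (mk_eq_mk_iff_mul_mem u 1).1 ((mem_classVal_iff q hu).1 h)
    rwa [mul_one] at this
  have hχ : discChar Δ u = 1 := by
    obtain ⟨n, hn⟩ := Int.eq_ofNat_of_zero_le ha.le
    have hodd : Odd n := by
      rw [hn] at h2
      exact Nat.coprime_two_right.1 (Nat.isCoprime_iff_coprime.1 h2)
    apply Units.ext
    rw [discChar_eq_jacobiSym hodd (by rw [hu, hn]; simp), Units.val_one]
    refine jacobiSym_disc_eq_one_of_sq (b := q.1.b) (y := 1) isCoprime_one_left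
      (by rw [← show _ = (n : ℤ) from hn]; exact hc.symm) ⟨4 * q.1.c, ?_⟩
    rw [← show _ = (n : ℤ) from hn]
    have hd : q.1.b ^ 2 - 4 * q.1.a * q.1.c = Δ := q.2.2
    linear_combination hd
  have hval : u ∈ valSubgroup Δ := by
    rcases hmem with h | h
    · exact h
    · have h1 := MonoidHom.mem_ker.1 (valSubgroup_le_ker_discChar h)
      rw [discChar_neg, hχ] at h1
      exact absurd h1 (by decide)
  obtain ⟨x, y, hxy⟩ := mem_val_iff.1 (show u ∈ val Δ (principalForm Δ) from hval)
  rw [hu, intCast_natAbs_dvd] at hxy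
  obtain ⟨x', y', m, hc', hm, he⟩ := exists_eval_eq_sq q ha hc (δ := ⟨x, -y⟩)
    (by rwa [norm_eq_eval_principalForm, neg_neg])
  obtain ⟨q', hq', ha'⟩ := exists_mk_eq_of_isCoprime q hc' (by rw [he]; exact hm.pow_left)
  rw [← hq']
  exact isSquare_mk_of_eq_sq q' hm (ha'.trans he)

/-- Every unit in the kernel of `χ` is the leading coefficient of a form. -/
theorem exists_primForm_of_discChar_eq_one {u : (ZMod Δ.natAbs)ˣ} (hu : discChar Δ u = 1) :
    ∃ q : PrimForm ℤ Δ, (u : ZMod Δ.natAbs) = q.1.a := by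
  obtain ⟨p, hp2, hp, hpu⟩ := Nat.forall_exists_prime_gt_and_eq_mod u.isUnit 2
  have : Fact p.Prime := ⟨hp⟩
  have hodd : Odd p := hp.odd_of_ne_two (by omega)
  have hc : IsCoprime (p : ℤ) Δ := isCoprime_of_cast_eq_unit (u := u) (by simpa using hpu)
  have h1 := discChar_eq_jacobiSym hodd hpu
  rw [hu, ← jacobiSym.legendreSym.to_jacobiSym, Units.val_one] at h1
  have hne : (Δ : ZMod p) ≠ 0 := by
    rw [Ne, ZMod.intCast_zmod_eq_zero_iff_dvd]
    intro hd
    exact (Nat.prime_iff_prime_int.1 hp).not_isUnit (hc.isUnit_of_dvd' dvd_rfl hd)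
  obtain ⟨b, hb⟩ := (legendreSym.eq_one_iff p hne).1 h1.symm
  obtain ⟨b, rfl⟩ := ZMod.intCast_surjective b
  have hb' : (p : ℤ) ∣ b ^ 2 - Δ := by
    rw [← ZMod.intCast_zmod_eq_zero_iff_dvd]
    push_cast
    rw [hb]
    ring
  obtain ⟨w, hw⟩ := hb'
  obtain ⟨h, hh⟩ := hodd
  have hh' : (p : ℤ) = 2 * h + 1 := by exact_mod_cast hh
  have h4 := four_mul_par (Δ := Δ)
  -- Since h + 1 inverts 2 modulo p = 2h + 1, k = (h + 1)(b + π) satisfies 2k − π ≡ b, a square root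
  -- of Δ modulo p.
  have hd : (p : ℤ) ∣ ((h + 1) * (b + parity Δ)) ^ 2 - ((h + 1) * (b + parity Δ)) * parity Δ -
      (Δ - parity Δ ^ 2) / 4 := by
    have hp4 : IsCoprime (p : ℤ) 4 := by
      have : IsCoprime (p : ℤ) 2 := ⟨1, -h, by linarith⟩
      simpa using this.pow_right (n := 2)
    apply hp4.dvd_of_dvd_mul_left
    refine ⟨w + (b + parity Δ) * (2 * b + p * (b + parity Δ)), ?_⟩
    have e : 2 * ((h + 1 : ℤ) * (b + parity Δ)) = (p + 1) * (b + parity Δ) := by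
      rw [hh']; ring
    linear_combination hw - h4 + (2 * ((h + 1 : ℤ) * (b + parity Δ)) - 2 * parity Δ +
      (p + 1) * (b + parity Δ)) * e
  obtain ⟨c, hc'⟩ := hd
  obtain ⟨q, hq⟩ := exists_primForm hc hc'.symm
  exact ⟨q, by rw [hq, ← hpu]; simp⟩

end Composition

end GenusTheory

open GenusTheory
theorem mainTheorem8 (Δ : ℤ) [NegDisc Δ] :
    valSubgroup Δ ≤ (discChar Δ).ker ∧
    Function.Bijective (phi Δ) ∧
    ∃ ψ : ClTw ℤ Δ →* (ZMod Δ.natAbs)ˣ ⧸ pmValSubgroup Δ,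
      IsGenusHom ψ ∧
      ψ.ker = Subgroup.square (ClTw ℤ Δ) ∧
      ∃ Ψ : ClTw ℤ Δ ⧸ Subgroup.square (ClTw ℤ Δ) ≃* (ZMod Δ.natAbs)ˣ ⧸ pmValSubgroup Δ,
        ∀ C : ClTw ℤ Δ, Ψ (C : ClTw ℤ Δ ⧸ Subgroup.square (ClTw ℤ Δ)) = ψ C := by
  have hex : ∀ C : ClTw ℤ Δ, ∃ g : (ZMod Δ.natAbs)ˣ ⧸ pmValSubgroup Δ,
      {u : (ZMod Δ.natAbs)ˣ | (u : (ZMod Δ.natAbs)ˣ ⧸ pmValSubgroup Δ) = g} = classVal C := by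
    intro C
    obtain ⟨q, rfl, -, hc, -⟩ := exists_mk_eq_pos C one_ne_zero
    obtain ⟨u, hu⟩ := exists_unit_of_isCoprime hc
    exact ⟨u, Set.ext fun v => (mem_classVal_iff q hu).symm⟩
  choose f hf using hex
  have hfmk : ∀ (q : PrimForm ℤ Δ) (u : (ZMod Δ.natAbs)ˣ), (u : ZMod Δ.natAbs) = q.1.a →
      f (ClTw.mk q) = u := by
    intro q u hu
    have h1 : u ∈ classVal (ClTw.mk q) := (mem_classVal_iff q hu).2 rfl
    rw [← hf] at h1
    exact (show _ = f (ClTw.mk q) from h1).symm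
  have hmul : ∀ C D, f (C * D) = f C * f D := by
    intro C D
    obtain ⟨q₁, q₂, q₃, rfl, rfl, h₃, ha, hc₁, hc₂⟩ := exists_mk_mul_mk C D
    obtain ⟨u₁, hu₁⟩ := exists_unit_of_isCoprime hc₁
    obtain ⟨u₂, hu₂⟩ := exists_unit_of_isCoprime hc₂
    rw [← h₃, hfmk q₁ u₁ hu₁, hfmk q₂ u₂ hu₂,
      hfmk q₃ (u₁ * u₂) (by rw [ha, Units.val_mul, hu₁, hu₂, Int.cast_mul]), QuotientGroup.mk_mul]
  obtain ⟨ψ, hψ⟩ : ∃ ψ : ClTw ℤ Δ →* (ZMod Δ.natAbs)ˣ ⧸ pmValSubgroup Δ, ∀ C, ψ C = f C :=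
    ⟨MonoidHom.mk' f hmul, fun _ => rfl⟩
  have hker : ψ.ker = Subgroup.square (ClTw ℤ Δ) := by
    ext C
    rw [MonoidHom.mem_ker, Subgroup.mem_square]
    constructor
    · intro h
      apply isSquare_of_one_mem_classVal
      rw [← hf, ← hψ, h]
      rfl
    · rintro ⟨D, rfl⟩
      rw [map_mul]
      refine QuotientGroup.induction_on (ψ D) fun u => ?_
      rw [← QuotientGroup.mk_mul, QuotientGroup.eq_one_iff]
      exact Or.inl (sq_mem_valSubgroup u)
  have hsurj : Function.Surjective ψ := by
    intro g
    refine QuotientGroup.induction_on g fun u => ?_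
    -- Only units in ker χ are known to be leading coefficients; otherwise −u is in ker χ and has
    -- the same image.
    rcases Int.units_eq_one_or (discChar Δ u) with h | h
    · obtain ⟨q, hq⟩ := exists_primForm_of_discChar_eq_one h
      exact ⟨ClTw.mk q, by rw [hψ, hfmk q u hq]⟩
    · obtain ⟨q, hq⟩ := exists_primForm_of_discChar_eq_one (u := -u)
        (by rw [discChar_neg, h, neg_neg])
      refine ⟨ClTw.mk q, ?_⟩
      rw [hψ, hfmk q (-u) hq]
      exact (QuotientGroup.eq (s := pmValSubgroup Δ)).2 (Or.inr (by simp [one_mem]))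
  refine ⟨valSubgroup_le_ker_discChar, phi_bijective, ψ, fun C => ?_, hker,
    (QuotientGroup.quotientMulEquivOfEq hker.symm).trans
      (QuotientGroup.quotientKerEquivOfSurjective ψ hsurj), fun C => rfl⟩
  rw [hψ]
  exact hf C
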